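/- Let $0<b<1$ and let $\mathbb E^2=\{x^2+y^2+z^2/b^2=1\}\subset\mathbb R^3$, parametrized by $(x,y,z)=(\cos\theta\cos\varphi,\cos\theta\sin\varphi,b\sin\theta)$ with longitude $\varphi\in[-\pi,\pi)$ and latitude $\theta\in[-\frac\pi2,\frac\pi2]$, with its Riemannian area. Let $e_\varphi=(-\sin\varphi,\cos\varphi,0)$, let $u^\perp$ be the counter-clockwise rotation of a tangent field $u$ by $\pi/2$, and write $\nabla^\perp\psi=(\nabla\psi)^\perp$. For tangent $u\in L^2(\mathbb E^2)$ put $$\mathcal L[u]=\nabla^\perp\Delta^{-1}\operatorname{curl}\Big(\frac{-2\sin\theta}{\sqrt{\sin^2\theta+b^2\cos^2\theta}}\,u^\perp\Big),$$ that is, $\mathcal L[u]=\nabla^\perp\psi$, where $\psi\in H^1(\mathbb E^2)$ has zero mean and $\Delta\psi$ is the distributional curl of the field in brackets. Let $\operatorname{null}\mathcal L$ be the space of tangent fields $u\in L^2(\mathbb E^2)$ with $\operatorname{div}u=0$ (in the sense of distributions) and $\mathcal L[u]=0$; it is a closed subspace. Let $\Pi$ be the $L^2$-orthogonal projection onto $\operatorname{null}\mathcal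 L$, and let $\oint_{C(\theta)}$ be the integral with respect to arc length along the circle $C(\theta)\subset\mathbb E^2$ of latitude $\theta$. Let $u\in L^2(\mathbb E^2)$ be a tangent field with $\operatorname{div}u=0$. Then $u\cdot e_\varphi$ is integrable along $C(\theta)$ for almost every $\theta$, the field $\big(\oint_{C(\theta)}u\cdot e_\varphi\big)e_\varphi\big/\oint_{C(\theta)}e_\varphi\cdot e_\varphi$ is in $L^2(\mathbb E^2)$, and almost everywhere $$\Pi u=\Pi\,\frac{\big(\oint_{C(\theta)}u\cdot e_\varphi\big)e_\varphi}{\oint_{C(\theta)}e_\varphi\cdot e_\varphi}=\frac{\big(\oint_{C(\theta)}u\cdot e_\varphi\big)e_\varphi}{\oint_{C(\theta)}e_\varphi\cdot e_\varphi}=\frac{1}{2\pi\cos\theta}\Big(\oint_{C(\theta)}u\cdot e_\varphi\Big)e_\varphi .$$ In terms of the polar colatitude $\vartheta\in(0,\pi)$ of the same point, given by $(x,y,z)=(r\sin\vartheta\cos\varphi,r\sin\vartheta\sin\varphi,r\cos\vartheta)$ with $r>0$, the last expression is $$\frac{\sqrt{\sin^2\vartheta+\frac{\cos^2\vartheta}{b^2}}}{2\pi\sin\vartheta}\Big(\oint_{C(\theta)}u\cdot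 e_\varphi\Big)e_\varphi .$$ Moreover, $\Pi$ sends the stream function to its zonal mean: if $u=\nabla^\perp\Psi$ with $\Psi\in H^1(\mathbb E^2)$, then $\overline\Psi(\theta)=\frac1{2\pi}\int_{-\pi}^{\pi}\Psi\,d\varphi$ is in $H^1(\mathbb E^2)$ and $\Pi u=\nabla^\perp\overline\Psi$. -/

import Mathlib

open Real Set Filter Topology MeasureTheory
open scoped ENNReal ContDiff Matrix

noncomputable section

/-- Euclidean three-space. -/
abbrev E3 : Type := EuclideanSpace ℝ (Fin 3)

/-! ### The ellipsoid -/

/-- The parametrization of the biaxial ellipsoid `x² + y² + z²/b² = 1` by longitude `φ` and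
(parametric) latitude `θ`. -/
def ellipsoidPoint (b φ θ : ℝ) : E3 :=
  !₂[cos θ * cos φ, cos θ * sin φ, b * sin θ]

/-- The point with spherical polar coordinates: radius `r`, colatitude `ϑ`, longitude `φ`. -/
def sphericalPoint (r ϑ φ : ℝ) : E3 :=
  !₂[r * sin ϑ * cos φ, r * sin ϑ * sin φ, r * cos ϑ]

/-- The Riemannian area `cos θ √(sin² θ + b² cos² θ) dφ dθ` on the coordinate rectangle
`[-π, π) × [-π/2, π/2]` of pairs `(φ, θ)`. -/
def coordArea (b : ℝ) : Measure (ℝ × ℝ) :=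
  (volume.restrict (Ico (-π) π ×ˢ Icc (-(π / 2)) (π / 2))).withDensity fun p =>
    ENNReal.ofReal (cos p.2 * √(sin p.2 ^ 2 + b ^ 2 * cos p.2 ^ 2))

/-- The surface measure of the ellipsoid, as a measure on `ℝ³` carried by the ellipsoid. -/
def surfaceMeasure (b : ℝ) : Measure E3 :=
  (coordArea b).map fun p => ellipsoidPoint b p.1 p.2

/-- The gradient (up to a factor `2`) of the defining function `x² + y² + z²/b²`. -/
def conormal (b : ℝ) (x : E3) : E3 := !₂[x 0, x 1, x 2 / b ^ 2]

/-- The outward unit normal at a point of the ellipsoid. -/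
def unitNormal (b : ℝ) (x : E3) : E3 := ‖conormal b x‖⁻¹ • conormal b x

/-- `v ↦ v^⊥ = n × v`: the counter-clockwise rotation by `π/2` in the tangent plane at `x`
(on normal vectors it is `0`). -/
def rotPerp (b : ℝ) (x v : E3) : E3 :=
  WithLp.toLp 2 (crossProduct (WithLp.ofLp (unitNormal b x)) (WithLp.ofLp v))

/-- The unit vector field `e_φ`, pointing east. -/
def eastVector (x : E3) : E3 := (√(x 0 ^ 2 + x 1 ^ 2))⁻¹ • !₂[-x 1, x 0, 0]

/-- The integral `∮_{C(θ)} h` with respect to arc length over the latitude circle `C(θ)`. -/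
def latitudeIntegral (b θ : ℝ) (h : E3 → ℝ) : ℝ :=
  ∫ φ in (-π)..π, h (ellipsoidPoint b φ θ) * ‖deriv (fun s => ellipsoidPoint b s θ) φ‖

/-- The zonal mean `(2π)⁻¹ ∫ ψ dφ` of a scalar function at latitude `θ`. -/
def zonalMean (b θ : ℝ) (ψ : E3 → ℝ) : ℝ :=
  (2 * π)⁻¹ * ∫ φ in (-π)..π, ψ (ellipsoidPoint b φ θ)

/-! ### Square integrable functions and fields; differential operators -/

/-- Square integrable functions on the ellipsoid. -/
abbrev L2Fun (b : ℝ) : Type := Lp ℝ 2 (surfaceMeasure b)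

/-- Square integrable `ℝ³`-valued fields on the ellipsoid. -/
abbrev L2Field (b : ℝ) : Type := Lp E3 2 (surfaceMeasure b)

/-- The field is tangent to the ellipsoid. -/
def IsTangent (b : ℝ) (u : L2Field b) : Prop :=
  ∀ᵐ x ∂(surfaceMeasure b), inner ℝ (unitNormal b x) (u x) = 0

/-- The gradient on the ellipsoid of (the restriction of) a smooth function on `ℝ³`: the
tangential part of its gradient.  Smooth functions on the ellipsoid are exactly the
restrictions of smooth functions on `ℝ³`. -/
def surfGrad (b : ℝ) (f : E3 → ℝ) (x : E3) : E3 :=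
  gradient f x - inner ℝ (unitNormal b x) (gradient f x) • unitNormal b x

/-- `div u = 0` in the sense of distributions, for a square integrable tangent field. -/
def IsDivFree (b : ℝ) (u : L2Field b) : Prop :=
  IsTangent b u ∧
    ∀ f : E3 → ℝ, ContDiff ℝ ∞ f → ∫ x, inner ℝ (u x) (surfGrad b f x) ∂(surfaceMeasure b) = 0

/-- `ψ` is in the Sobolev space `H¹` of the ellipsoid, with gradient `G`: the pair `(ψ, G)` is
the `L²` limit of pairs `(f, ∇f)` with `f` smooth. -/
def HasSobolevGrad (b : ℝ) (ψ : L2Fun b) (G : L2Field b) : Prop :=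
  IsTangent b G ∧
    ∃ f : ℕ → E3 → ℝ, (∀ k, ContDiff ℝ ∞ (f k)) ∧
      Tendsto (fun k => eLpNorm (fun x => f k x - ψ x) 2 (surfaceMeasure b)) atTop (𝓝 0) ∧
      Tendsto (fun k => eLpNorm (fun x => surfGrad b (f k) x - G x) 2 (surfaceMeasure b))
        atTop (𝓝 0)

/-- The distribution `Δψ`, where `G = ∇ψ`. -/
def distribLaplacian (b : ℝ) (G : E3 → E3) (f : E3 → ℝ) : ℝ :=
  -∫ x, inner ℝ (G x) (surfGrad b f x) ∂(surfaceMeasure b)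

/-- The distribution `curl w`, with the sign for which `curl ∇^⊥ = Δ`. -/
def distribCurl (b : ℝ) (w : E3 → E3) (f : E3 → ℝ) : ℝ :=
  -∫ x, inner ℝ (w x) (rotPerp b x (surfGrad b f x)) ∂(surfaceMeasure b)

/-- The Coriolis profile `-2 sin θ / √(sin² θ + b² cos² θ)` at a point of the ellipsoid, where
`sin θ = z/b` and `cos² θ = x² + y²`. -/
def coriolis (b : ℝ) (x : E3) : ℝ :=
  -2 * (x 2 / b) / √((x 2 / b) ^ 2 + b ^ 2 * (x 0 ^ 2 + x 1 ^ 2))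

theorem coriolis_ellipsoidPoint {b : ℝ} (hb : 0 < b) (φ θ : ℝ) :
    coriolis b (ellipsoidPoint b φ θ) = -2 * sin θ / √(sin θ ^ 2 + b ^ 2 * cos θ ^ 2) := by
  have h1 : (cos θ * cos φ) ^ 2 + (cos θ * sin φ) ^ 2 = cos θ ^ 2 := by
    linear_combination cos θ ^ 2 * sin_sq_add_cos_sq φ
  simp [coriolis, ellipsoidPoint, h1, hb.ne']

/-- `v = 𝓛[u] = ∇^⊥ Δ⁻¹ curl (c u^⊥)` with the Coriolis profile `c`: `v = ∇^⊥ψ`, where `ψ` is the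
solution in `H¹` with zero mean of `Δψ = curl (c u^⊥)`. -/
def IsCoriolisOp (b : ℝ) (u v : L2Field b) : Prop :=
  ∃ (ψ : L2Fun b) (G : L2Field b), HasSobolevGrad b ψ G ∧
    ∫ x, ψ x ∂(surfaceMeasure b) = 0 ∧
    (∀ f : E3 → ℝ, ContDiff ℝ ∞ f →
      distribLaplacian b G f = distribCurl b (fun x => coriolis b x • rotPerp b x (u x)) f) ∧
    ∀ᵐ x ∂(surfaceMeasure b), v x = rotPerp b x (G x)

/-! ### The null space of `𝓛` among divergence free fields -/

theorem continuous_ellipsoidPoint (b : ℝ) :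
    Continuous fun p : ℝ × ℝ => ellipsoidPoint b p.1 p.2 := by
  unfold ellipsoidPoint
  refine (PiLp.continuous_toLp 2 _).comp (continuous_pi fun i => ?_)
  fin_cases i <;> simp <;> fun_prop

theorem ae_surfaceMeasure_of {b : ℝ} {P : E3 → Prop} (hP : MeasurableSet {x | P x})
    (h : ∀ φ θ, cos θ ≠ 0 → P (ellipsoidPoint b φ θ)) : ∀ᵐ x ∂(surfaceMeasure b), P x := by
  unfold surfaceMeasure
  rw [ae_map_iff (continuous_ellipsoidPoint b).aemeasurable hP]
  unfold coordArea
  rw [ae_withDensity_iff (by fun_prop)]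
  refine ae_of_all _ fun p hp => h _ _ fun h0 => hp ?_
  simp [h0]

instance isFiniteMeasure_surfaceMeasure (b : ℝ) : IsFiniteMeasure (surfaceMeasure b) := by
  unfold surfaceMeasure
  have : IsFiniteMeasure (coordArea b) := by
    unfold coordArea
    refine isFiniteMeasure_withDensity_ofReal (Integrable.hasFiniteIntegral ?_)
    have h : Continuous fun p : ℝ × ℝ =>
        cos p.2 * √(sin p.2 ^ 2 + b ^ 2 * cos p.2 ^ 2) := by fun_prop
    exact (h.continuousOn.integrableOn_compact
      ((isCompact_Icc (a := -π) (b := π)).prod isCompact_Icc)).mono_set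
      (prod_mono Ico_subset_Icc_self subset_rfl)
  infer_instance

theorem measurable_unitNormal (b : ℝ) : Measurable (unitNormal b) := by
  have : Measurable (conormal b) := by
    unfold conormal
    refine (PiLp.continuous_toLp 2 _).measurable.comp (measurable_pi_lambda _ fun i => ?_)
    fin_cases i <;> simp <;> fun_prop
  unfold unitNormal
  fun_prop

theorem norm_unitNormal_le (b : ℝ) (x : E3) : ‖unitNormal b x‖ ≤ 1 := by
  unfold unitNormal
  rw [norm_smul, norm_inv, norm_norm]
  exact inv_mul_le_one

theorem ae_norm_unitNormal (b : ℝ) : ∀ᵐ x ∂(surfaceMeasure b), ‖unitNormal b x‖ = 1 := by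
  refine ae_surfaceMeasure_of (measurableSet_eq_fun (measurable_unitNormal b).norm
    measurable_const) fun φ θ h => ?_
  unfold unitNormal
  rw [norm_smul, norm_inv, norm_norm]
  refine inv_mul_cancel₀ fun h0 => h ?_
  rw [norm_eq_zero] at h0
  have h1 : cos θ * cos φ = 0 := by simpa [conormal, ellipsoidPoint] using congrArg (· 0) h0
  have h2 : cos θ * sin φ = 0 := by simpa [conormal, ellipsoidPoint] using congrArg (· 1) h0
  have : cos θ ^ 2 = 0 := by
    linear_combination (-cos θ ^ 2) * sin_sq_add_cos_sq φ + (cos θ * cos φ) * h1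
      + (cos θ * sin φ) * h2
  exact pow_eq_zero_iff two_ne_zero |>.1 this

theorem inner_rotPerp (b : ℝ) (x v w : E3) :
    inner ℝ (rotPerp b x v) w = -inner ℝ v (rotPerp b x w) := by
  simp [rotPerp, PiLp.inner_apply, Fin.sum_univ_three, cross_apply]
  ring

theorem norm_rotPerp_sq (b : ℝ) (x v : E3) :
    ‖rotPerp b x v‖ ^ 2 = ‖unitNormal b x‖ ^ 2 * ‖v‖ ^ 2 - inner ℝ (unitNormal b x) v ^ 2 := by
  simp only [EuclideanSpace.norm_sq_eq, PiLp.inner_apply, Fin.sum_univ_three]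
  simp [rotPerp, cross_apply]
  ring

theorem norm_rotPerp_le (b : ℝ) (x v : E3) : ‖rotPerp b x v‖ ≤ ‖v‖ := by
  refine le_of_sq_le_sq ?_ (norm_nonneg _)
  rw [norm_rotPerp_sq]
  have h := norm_unitNormal_le b x
  have h2 : ‖unitNormal b x‖ ^ 2 ≤ 1 := pow_le_one₀ (norm_nonneg _) h
  nlinarith [sq_nonneg ‖v‖, sq_nonneg (inner ℝ (unitNormal b x) v)]

theorem measurable_coriolis (b : ℝ) : Measurable (coriolis b) := by
  unfold coriolis
  fun_prop

theorem abs_coriolis_le (b : ℝ) (x : E3) : |coriolis b x| ≤ 2 := by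
  unfold coriolis
  set s := x 2 / b
  have h : |s| ≤ √(s ^ 2 + b ^ 2 * (x 0 ^ 2 + x 1 ^ 2)) :=
    Real.abs_le_sqrt (le_add_of_nonneg_right (by positivity))
  rw [abs_div, abs_mul, abs_of_nonneg (Real.sqrt_nonneg _)]
  refine div_le_of_le_mul₀ (Real.sqrt_nonneg _) (by norm_num) ?_
  rw [abs_neg, abs_two]
  gcongr

theorem measurable_cross {n w : E3 → E3} (hn : Measurable n) (hw : Measurable w) :
    Measurable fun x => (WithLp.toLp 2 (crossProduct (WithLp.ofLp (n x)) (WithLp.ofLp (w x))) : E3) := by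
  have hc : ∀ i, Measurable fun y : E3 => y i := fun i => by fun_prop
  have h : ∀ i j k l, Measurable fun x => n x i * w x j - n x k * w x l := fun i j k l =>
    (((hc i).comp hn).mul ((hc j).comp hw)).sub (((hc k).comp hn).mul ((hc l).comp hw))
  refine (PiLp.continuous_toLp 2 _).measurable.comp (measurable_pi_lambda _ fun i => ?_)
  simp only [cross_apply]
  fin_cases i
  · exact h 1 2 2 1
  · exact h 2 0 0 2
  · exact h 0 1 1 0

theorem measurable_rotPerp {b : ℝ} {w : E3 → E3} (hw : Measurable w) :
    Measurable fun x => rotPerp b x (w x) :=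
  measurable_cross (measurable_unitNormal b) hw

theorem memLp_surfGrad (b : ℝ) {f : E3 → ℝ} (hf : ContDiff ℝ ∞ f) :
    MemLp (surfGrad b f) 2 (surfaceMeasure b) := by
  have hg : Continuous (gradient f) :=
    (InnerProductSpace.toDual ℝ E3).symm.continuous.comp (hf.continuous_fderiv (by simp))
  have hm : Measurable (surfGrad b f) := by
    have hn := measurable_unitNormal b
    have hg' := hg.measurable
    unfold surfGrad
    fun_prop
  have hK : IsCompact ((fun p : ℝ × ℝ => ellipsoidPoint b p.1 p.2) ''
      (Icc (-π) π ×ˢ Icc (-(π / 2)) (π / 2))) :=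
    ((isCompact_Icc.prod isCompact_Icc).image (continuous_ellipsoidPoint b))
  obtain ⟨C, hC⟩ := hK.exists_bound_of_continuousOn hg.continuousOn
  refine MemLp.of_bound hm.aestronglyMeasurable (C + C) ?_
  have hset : MeasurableSet {x | ‖surfGrad b f x‖ ≤ C + C} :=
    measurableSet_le hm.norm measurable_const
  unfold surfaceMeasure
  rw [ae_map_iff (continuous_ellipsoidPoint b).aemeasurable hset]
  refine (withDensity_absolutelyContinuous _ _).ae_le ?_
  refine (ae_restrict_iff' (measurableSet_Ico.prod measurableSet_Icc)).2 (ae_of_all _ ?_)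
  intro p hp
  have h1 := hC _ (mem_image_of_mem _ ⟨Ico_subset_Icc_self hp.1, hp.2⟩)
  set x := ellipsoidPoint b p.1 p.2
  have hn := norm_unitNormal_le b x
  calc ‖surfGrad b f x‖ ≤ ‖gradient f x‖ + ‖inner ℝ (unitNormal b x) (gradient f x) •
        unitNormal b x‖ := norm_sub_le _ _
    _ ≤ C + C := by
        refine add_le_add h1 (le_trans ?_ h1)
        rw [norm_smul]
        calc _ ≤ (‖unitNormal b x‖ * ‖gradient f x‖) * ‖unitNormal b x‖ := by
              gcongr; exact norm_inner_le_norm _ _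
          _ ≤ (1 * ‖gradient f x‖) * 1 := by gcongr
          _ = _ := by ring

/-- The field `K` for which the distribution `curl (c u^⊥)` is `f ↦ ∫ u · K`. -/
def curlKernel (b : ℝ) (f : E3 → ℝ) (x : E3) : E3 :=
  coriolis b x • rotPerp b x (rotPerp b x (surfGrad b f x))

theorem memLp_curlKernel (b : ℝ) {f : E3 → ℝ} (hf : ContDiff ℝ ∞ f) :
    MemLp (curlKernel b f) 2 (surfaceMeasure b) := by
  refine (memLp_surfGrad b hf).of_le_mul (c := 2) ?_ (ae_of_all _ fun x => ?_)
  · have hg : Continuous (gradient f) :=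
      (InnerProductSpace.toDual ℝ E3).symm.continuous.comp (hf.continuous_fderiv (by simp))
    have hm : Measurable (surfGrad b f) := by
      have hn := measurable_unitNormal b
      have hg' := hg.measurable
      unfold surfGrad
      fun_prop
    exact ((measurable_coriolis b).smul
      (measurable_rotPerp (measurable_rotPerp hm))).aestronglyMeasurable
  · unfold curlKernel
    rw [norm_smul]
    exact mul_le_mul (abs_coriolis_le b x)
      ((norm_rotPerp_le b x _).trans (norm_rotPerp_le b x _)) (norm_nonneg _) (by norm_num)

theorem integral_inner_eq {b : ℝ} (u : L2Field b) {K : E3 → E3}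
    (hK : MemLp K 2 (surfaceMeasure b)) :
    ∫ x, inner ℝ (u x) (K x) ∂(surfaceMeasure b) = inner ℝ u (hK.toLp K) := by
  rw [L2.inner_def]
  refine integral_congr_ae ?_
  filter_upwards [hK.coeFn_toLp] with x hx
  rw [hx]

theorem distribCurl_eq {b : ℝ} (u : L2Field b) {f : E3 → ℝ} (hf : ContDiff ℝ ∞ f) :
    distribCurl b (fun x => coriolis b x • rotPerp b x (u x)) f
      = inner ℝ u ((memLp_curlKernel b hf).toLp _) := by
  rw [← integral_inner_eq, distribCurl, ← integral_neg]
  refine integral_congr_ae (ae_of_all _ fun x => ?_)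
  simp only [curlKernel, inner_smul_left, inner_smul_right, inner_rotPerp]
  simp

theorem isClosed_isTangent (b : ℝ) : IsClosed {u : L2Field b | IsTangent b u} := by
  refine IsSeqClosed.isClosed fun u v hu huv => ?_
  obtain ⟨ns, -, hns⟩ := (tendstoInMeasure_of_tendsto_Lp huv).exists_seq_tendsto_ae
  have h : ∀ᵐ x ∂(surfaceMeasure b), ∀ k, inner ℝ (unitNormal b x) (u k x) = 0 :=
    ae_all_iff.2 hu
  show ∀ᵐ x ∂(surfaceMeasure b), _
  filter_upwards [hns, h] with x h1 h2
  have h3 := (tendsto_const_nhds (x := unitNormal b x)).inner (𝕜 := ℝ) h1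
  simp only [h2] at h3
  exact (tendsto_nhds_unique h3 tendsto_const_nhds)

theorem IsTangent.add {b : ℝ} {u v : L2Field b} (hu : IsTangent b u) (hv : IsTangent b v) :
    IsTangent b (u + v) := by
  unfold IsTangent at *
  filter_upwards [hu, hv, Lp.coeFn_add u v] with x h1 h2 h3
  rw [h3, Pi.add_apply, inner_add_right, h1, h2, add_zero]

theorem IsTangent.smul {b : ℝ} (c : ℝ) {u : L2Field b} (hu : IsTangent b u) :
    IsTangent b (c • u) := by
  unfold IsTangent at *
  filter_upwards [hu, Lp.coeFn_smul c u] with x h1 h2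
  rw [h2, Pi.smul_apply, inner_smul_right, h1, mul_zero]

theorem isTangent_zero (b : ℝ) : IsTangent b 0 := by
  unfold IsTangent
  filter_upwards [Lp.coeFn_zero E3 2 (surfaceMeasure b)] with x h
  rw [h, Pi.zero_apply, inner_zero_right]

theorem hasSobolevGrad_zero (b : ℝ) : HasSobolevGrad b 0 0 := by
  refine ⟨isTangent_zero b, fun _ => 0, fun _ => contDiff_const, ?_, ?_⟩
  · refine tendsto_const_nhds.congr fun k => ?_
    rw [eq_comm, ← eLpNorm_zero (ε := ℝ) (p := 2) (μ := surfaceMeasure b)]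
    refine eLpNorm_congr_ae ?_
    filter_upwards [Lp.coeFn_zero ℝ 2 (surfaceMeasure b)] with x h
    rw [h]
    simp
  · refine tendsto_const_nhds.congr fun k => ?_
    rw [eq_comm, ← eLpNorm_zero (ε := E3) (p := 2) (μ := surfaceMeasure b)]
    refine eLpNorm_congr_ae ?_
    filter_upwards [Lp.coeFn_zero E3 2 (surfaceMeasure b)] with x h
    have : gradient (0 : E3 → ℝ) x = 0 := gradient_fun_const x 0
    rw [h]
    simp [surfGrad, this]

/-- `𝓛[u] = 0` if and only if `curl (c u^⊥) = 0`. -/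
theorem isCoriolisOp_zero_iff {b : ℝ} (u : L2Field b) :
    IsCoriolisOp b u 0 ↔ ∀ f : E3 → ℝ, ContDiff ℝ ∞ f →
      distribCurl b (fun x => coriolis b x • rotPerp b x (u x)) f = 0 := by
  constructor
  · rintro ⟨ψ, G, ⟨hG, -⟩, -, h, h0⟩ f hf
    rw [← h f hf, distribLaplacian, neg_eq_zero]
    refine integral_eq_zero_of_ae ?_
    filter_upwards [h0, hG, ae_norm_unitNormal b, Lp.coeFn_zero E3 2 (surfaceMeasure b)]
      with x h1 h2 h3 h4
    rw [h4, Pi.zero_apply] at h1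
    have h5 := norm_rotPerp_sq b x (G x)
    rw [← h1, h2, h3] at h5
    have h6 : G x = 0 := by
      rw [← norm_eq_zero, ← pow_eq_zero_iff two_ne_zero]
      simpa using h5.symm
    simp [h6]
  · intro h
    refine ⟨0, 0, hasSobolevGrad_zero b, ?_, fun f hf => ?_, ?_⟩
    · refine integral_eq_zero_of_ae (Lp.coeFn_zero ℝ 2 (surfaceMeasure b))
    · rw [h f hf, distribLaplacian, neg_eq_zero]
      refine integral_eq_zero_of_ae ?_
      filter_upwards [Lp.coeFn_zero E3 2 (surfaceMeasure b)] with x h4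
      rw [h4]
      simp
    · filter_upwards [Lp.coeFn_zero E3 2 (surfaceMeasure b)] with x h4
      rw [h4]
      simp [rotPerp]

/-- The null space of `𝓛` in the space of square integrable divergence free fields. -/
def nullL (b : ℝ) : Submodule ℝ (L2Field b) where
  carrier := {u | IsDivFree b u ∧ IsCoriolisOp b u 0}
  zero_mem' := by
    refine ⟨⟨isTangent_zero b, fun f hf => ?_⟩, (isCoriolisOp_zero_iff 0).2 fun f hf => ?_⟩
    · rw [integral_inner_eq 0 (memLp_surfGrad b hf), inner_zero_left]
    · rw [distribCurl_eq 0 hf, inner_zero_left]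
  add_mem' := by
    rintro u v ⟨⟨hu1, hu2⟩, hu3⟩ ⟨⟨hv1, hv2⟩, hv3⟩
    rw [isCoriolisOp_zero_iff] at hu3 hv3
    refine ⟨⟨hu1.add hv1, fun f hf => ?_⟩, (isCoriolisOp_zero_iff _).2 fun f hf => ?_⟩
    · have h1 := hu2 f hf
      have h2 := hv2 f hf
      rw [integral_inner_eq _ (memLp_surfGrad b hf)] at h1 h2 ⊢
      rw [inner_add_left, h1, h2, add_zero]
    · have h1 := hu3 f hf
      have h2 := hv3 f hf
      rw [distribCurl_eq _ hf] at h1 h2 ⊢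
      rw [inner_add_left, h1, h2, add_zero]
  smul_mem' := by
    rintro c u ⟨⟨hu1, hu2⟩, hu3⟩
    rw [isCoriolisOp_zero_iff] at hu3
    refine ⟨⟨hu1.smul c, fun f hf => ?_⟩, (isCoriolisOp_zero_iff _).2 fun f hf => ?_⟩
    · have h1 := hu2 f hf
      rw [integral_inner_eq _ (memLp_surfGrad b hf)] at h1 ⊢
      rw [real_inner_smul_left, h1, mul_zero]
    · have h1 := hu3 f hf
      rw [distribCurl_eq _ hf] at h1 ⊢
      rw [real_inner_smul_left, h1, mul_zero]

theorem isClosed_nullL (b : ℝ) : IsClosed (nullL b : Set (L2Field b)) := by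
  have h : (nullL b : Set (L2Field b)) = {u | IsTangent b u} ∩
      ((⋂ (f : E3 → ℝ) (hf : ContDiff ℝ ∞ f),
        {u : L2Field b | inner ℝ u ((memLp_surfGrad b hf).toLp _) = 0}) ∩
      (⋂ (f : E3 → ℝ) (hf : ContDiff ℝ ∞ f),
        {u : L2Field b | inner ℝ u ((memLp_curlKernel b hf).toLp _) = 0})) := by
    ext u
    have h0 : u ∈ nullL b ↔ IsDivFree b u ∧ IsCoriolisOp b u 0 := Iff.rfl
    rw [SetLike.mem_coe, h0, isCoriolisOp_zero_iff, IsDivFree, and_assoc]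
    refine and_congr Iff.rfl (and_congr ?_ ?_)
    · rw [mem_iInter₂]
      refine forall₂_congr fun f hf => ?_
      rw [integral_inner_eq u (memLp_surfGrad b hf)]
      rfl
    · rw [mem_iInter₂]
      refine forall₂_congr fun f hf => ?_
      rw [distribCurl_eq u hf]
      rfl
  rw [h]
  refine (isClosed_isTangent b).inter (IsClosed.inter ?_ ?_)
  · exact isClosed_iInter fun f => isClosed_iInter fun hf =>
      isClosed_eq (by fun_prop) continuous_const
  · exact isClosed_iInter fun f => isClosed_iInter fun hf =>
      isClosed_eq (by fun_prop) continuous_const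

instance hasOrthogonalProjection_nullL (b : ℝ) : (nullL b).HasOrthogonalProjection :=
  have : CompleteSpace (nullL b) := (isClosed_nullL b).completeSpace_coe
  inferInstance

/-- The `L²`-orthogonal projection onto the null space of `𝓛`. -/
def projNull (b : ℝ) : L2Field b →L[ℝ] L2Field b := (nullL b).starProjection

end

/-! Write c for the Coriolis profile, e for the unit field pointing east, N for the one pointing
north, and M for the zonal mean.

Rotation by a right angle is an isometry of each tangent plane, so weakly curl(c v^⊥) = div(c v). A
tangent L² field v therefore lies in the null space exactly when div v = 0 and div(c v) = 0
(`mem_nullL_iff`). By the Leibniz rule these give v · ∇c = 0. On the ellipsoid c is a smooth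
function of z alone with nowhere vanishing derivative, so v is horizontal
(`third_component_eq_zero`), that is, v = v₁ e (`nullL_eq_smul_east`). Then div v = 0 says that v₁
does not depend on longitude (`inner_east_eq_zonalLift`). Conversely, zonal fields a(θ) e lie in the
null space, because the longitudinal derivative of a test function integrates to zero around each
circle (`zonal_field_mem_nullL`).

So the null space consists of the zonal fields. By Fubini, M is symmetric and contracts the L² norm
(`integral_zonalLift_mul`, `eLpNorm_zonalLift_le`), hence the projection is u ↦ M(u · e) e
(`projNull_ae_eq`). The circle at latitude θ has radius cos θ, which turns means into line
integrals.

For stream functions, M is realized on smooth functions by averaging over rotations of space about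
the axis. The average is again smooth, and its surface gradient is the mean northward derivative
times N (`surfGrad_axialMean`). The contraction property carries this to the Sobolev limit, and N^⊥
= -e matches the result with the projection. -/

noncomputable section

/-! ### Smooth dependence of integrals on parameters -/

section Parametric

variable {E G : Type} [NormedAddCommGroup E] [NormedSpace ℝ E]
  [NormedAddCommGroup G] [NormedSpace ℝ G]

/-- Dominated differentiation under the integral: in finite dimension a closed ball times the
interval is compact, so the continuous partial derivative is bounded there by a constant. -/
theorem hasFDerivAt_parametric_intervalIntegral [FiniteDimensional ℝ E] {F : E × ℝ → G} (hF : ContDiff ℝ 1 F)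
    (a b : ℝ) (x₀ : E) :
    HasFDerivAt (fun x => ∫ t in a..b, F (x, t))
      (∫ t in a..b, (fderiv ℝ F (x₀, t)).comp (ContinuousLinearMap.inl ℝ E ℝ)) x₀ := by
  have : ProperSpace E := FiniteDimensional.proper_real E
  have hc : Continuous fun p : E × ℝ => (fderiv ℝ F p).comp (ContinuousLinearMap.inl ℝ E ℝ) :=
    (hF.continuous_fderiv one_ne_zero).clm_comp continuous_const
  obtain ⟨C, hC⟩ := ((isCompact_closedBall x₀ 1).prod
    (isCompact_uIcc (a := a) (b := b))).exists_bound_of_continuousOn hc.continuousOn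
  refine intervalIntegral.hasFDerivAt_integral_of_dominated_of_fderiv_le
    (F := fun x t => F (x, t))
    (F' := fun x t => (fderiv ℝ F (x, t)).comp (ContinuousLinearMap.inl ℝ E ℝ))
    (bound := fun _ => C) (Metric.closedBall_mem_nhds x₀ one_pos) ?_ ?_ ?_ ?_ ?_ ?_
  · exact Eventually.of_forall fun x =>
      (hF.continuous.comp (Continuous.prodMk_right x)).aestronglyMeasurable
  · exact (hF.continuous.comp (Continuous.prodMk_right x₀)).intervalIntegrable _ _
  · exact (hc.comp (Continuous.prodMk_right x₀)).aestronglyMeasurable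
  · exact ae_of_all _ fun t ht x hx => hC (x, t) ⟨hx, uIoc_subset_uIcc ht⟩
  · exact intervalIntegrable_const
  · refine ae_of_all _ fun t _ x _ => ?_
    exact ((hF.differentiable one_ne_zero) (x, t)).hasFDerivAt.comp x (hasFDerivAt_prodMk_left x t)

theorem contDiff_fderiv_comp_inl {F : E × ℝ → G} {n : ℕ∞} (hF : ContDiff ℝ (n + 1) F) :
    ContDiff ℝ n fun p => (fderiv ℝ F p).comp (ContinuousLinearMap.inl ℝ E ℝ) :=
  (hF.fderiv_right le_rfl).clm_comp contDiff_const

end Parametric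

/-- Induction on the order. `G` is quantified inside the statement because the derivative of the
integral is an integral of the same kind with values in a space of linear maps. -/
theorem contDiff_parametric_intervalIntegral_nat {E : Type} [NormedAddCommGroup E]
    [NormedSpace ℝ E] [FiniteDimensional ℝ E] (a b : ℝ) (n : ℕ) :
    ∀ {G : Type} [NormedAddCommGroup G] [NormedSpace ℝ G] {F : E × ℝ → G},
      ContDiff ℝ ∞ F → ContDiff ℝ n fun x => ∫ t in a..b, F (x, t) := by
  induction n with
  | zero =>
    intro G _ _ F hF
    simp only [Nat.cast_zero, contDiff_zero]
    exact intervalIntegral.continuous_parametric_intervalIntegral_of_continuous'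
      (f := fun x t => F (x, t)) hF.continuous a b
  | succ n ih =>
    intro G _ _ F hF
    have h := hasFDerivAt_parametric_intervalIntegral (hF.of_le (by simp)) a b
    push_cast
    rw [contDiff_succ_iff_fderiv]
    refine ⟨fun x => (h x).differentiableAt, by simp, ?_⟩
    rw [funext fun x => (h x).fderiv]
    exact ih (contDiff_fderiv_comp_inl (n := ⊤) hF)

/-- The integral over `[a, b]` of a smooth function depends smoothly on the parameter. -/
theorem contDiff_parametric_intervalIntegral {E G : Type} [NormedAddCommGroup E]
    [NormedSpace ℝ E] [FiniteDimensional ℝ E] [NormedAddCommGroup G] [NormedSpace ℝ G]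
    {F : E × ℝ → G} (hF : ContDiff ℝ ∞ F) (a b : ℝ) :
    ContDiff ℝ ∞ fun x => ∫ t in a..b, F (x, t) :=
  contDiff_infty.2 fun n => contDiff_parametric_intervalIntegral_nat a b n hF

/-! ### Rotations about the axis of the ellipsoid -/

/-- Rotation by the angle `α` about the third axis. -/
def axialRotation (α : ℝ) (x : E3) : E3 :=
  !₂[cos α * x 0 - sin α * x 1, sin α * x 0 + cos α * x 1, x 2]

theorem contDiff_axialRotation : ContDiff ℝ ∞ fun p : E3 × ℝ => axialRotation p.2 p.1 := by
  rw [contDiff_euclidean]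
  have h : ∀ i : Fin 3, ContDiff ℝ ∞ fun p : E3 × ℝ => p.1 i := fun i => by fun_prop
  have hc : ContDiff ℝ ∞ fun p : E3 × ℝ => cos p.2 := by fun_prop
  have hs : ContDiff ℝ ∞ fun p : E3 × ℝ => sin p.2 := by fun_prop
  intro i
  fin_cases i
  · simpa [axialRotation] using (hc.mul (h 0)).sub (hs.mul (h 1))
  · simpa [axialRotation] using (hs.mul (h 0)).add (hc.mul (h 1))
  · simpa [axialRotation] using h 2

theorem axialRotation_ellipsoidPoint (b α φ θ : ℝ) :
    axialRotation α (ellipsoidPoint b φ θ) = ellipsoidPoint b (φ + α) θ := by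
  ext i
  fin_cases i <;> simp [axialRotation, ellipsoidPoint, cos_add, sin_add] <;> ring

theorem axialRotation_add (α : ℝ) (x v : E3) :
    axialRotation α (x + v) = axialRotation α x + axialRotation α v := by
  ext i
  fin_cases i <;> simp [axialRotation] <;> ring

theorem axialRotation_smul (α c : ℝ) (x : E3) :
    axialRotation α (c • x) = c • axialRotation α x := by
  ext i
  fin_cases i <;> simp [axialRotation] <;> ring

theorem hasFDerivAt_axialRotation (α : ℝ) (x : E3) :
    ∃ A : E3 →L[ℝ] E3, (∀ v, A v = axialRotation α v) ∧ HasFDerivAt (axialRotation α) A x := by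
  let A : E3 →ₗ[ℝ] E3 := ⟨⟨axialRotation α, axialRotation_add α⟩, axialRotation_smul α⟩
  exact ⟨LinearMap.toContinuousLinearMap A, fun _ => rfl,
    (LinearMap.toContinuousLinearMap A).hasFDerivAt⟩

/-- The weighted mean `∫ κ(α) f(R_α x) dα` over the rotations about the axis. -/
def axialMean (κ : ℝ → ℝ) (f : E3 → ℝ) (a c : ℝ) (x : E3) : ℝ :=
  ∫ α in a..c, κ α * f (axialRotation α x)

theorem contDiff_axialMean_integrand {κ : ℝ → ℝ} {f : E3 → ℝ} (hκ : ContDiff ℝ ∞ κ)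
    (hf : ContDiff ℝ ∞ f) :
    ContDiff ℝ ∞ fun p : E3 × ℝ => κ p.2 * f (axialRotation p.2 p.1) :=
  (hκ.comp contDiff_snd).mul (hf.comp contDiff_axialRotation)

theorem contDiff_axialMean {κ : ℝ → ℝ} {f : E3 → ℝ} (hκ : ContDiff ℝ ∞ κ)
    (hf : ContDiff ℝ ∞ f) (a c : ℝ) : ContDiff ℝ ∞ (axialMean κ f a c) :=
  contDiff_parametric_intervalIntegral (contDiff_axialMean_integrand hκ hf) a c

/-- Rotations are linear, so each is its own derivative and the chain rule applies under the
integral sign. -/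
theorem fderiv_axialMean {κ : ℝ → ℝ} {f : E3 → ℝ} (hκ : ContDiff ℝ ∞ κ)
    (hf : ContDiff ℝ ∞ f) (a c : ℝ) (x v : E3) :
    fderiv ℝ (axialMean κ f a c) x v =
      ∫ α in a..c, κ α * fderiv ℝ f (axialRotation α x) (axialRotation α v) := by
  have hF := contDiff_axialMean_integrand hκ hf
  have h := hasFDerivAt_parametric_intervalIntegral (hF.of_le (by simp)) a c x
  have hc : Continuous fun t : ℝ => (fderiv ℝ (fun p : E3 × ℝ => κ p.2 *
      f (axialRotation p.2 p.1)) (x, t)).comp (ContinuousLinearMap.inl ℝ E3 ℝ) :=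
    (contDiff_fderiv_comp_inl (n := ⊤) hF).continuous.comp (Continuous.prodMk_right x)
  have h' : fderiv ℝ (axialMean κ f a c) x = _ := h.fderiv
  rw [h', ContinuousLinearMap.intervalIntegral_apply (hc.intervalIntegrable _ _)]
  refine intervalIntegral.integral_congr fun α _ => ?_
  obtain ⟨A, hA, hA'⟩ := hasFDerivAt_axialRotation α x
  have h1 : HasFDerivAt (fun y : E3 => κ α * f (axialRotation α y)) _ x :=
    ((hf.differentiable (by simp) (axialRotation α x)).hasFDerivAt.comp x hA').const_mul (κ α)
  -- The same derivative seen as a partial derivative of the joint integrand; uniqueness identifies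
  -- it with the chain-rule form `h1`.
  have h2 : HasFDerivAt (fun y : E3 => κ α * f (axialRotation α y)) _ x :=
    HasFDerivAt.comp (f := fun y : E3 => (y, α)) x
      (hF.differentiable (by simp) (x, α)).hasFDerivAt (hasFDerivAt_prodMk_left x α)
  have h3 := congrArg (fun B : E3 →L[ℝ] ℝ => B v) (h2.unique h1)
  simpa [hA] using h3

/-! ### The orthonormal frame -/

theorem cos_pos_of_mem {θ : ℝ} (hθ : θ ∈ Ioo (-(π / 2)) (π / 2)) : 0 < cos θ :=
  cos_pos_of_mem_Ioo hθ

/-- The speed `√(sin² θ + b² cos² θ)` of the meridian parametrization. -/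
def meridianSpeed (b θ : ℝ) : ℝ := √(sin θ ^ 2 + b ^ 2 * cos θ ^ 2)

theorem meridianSpeed_sq (b θ : ℝ) : meridianSpeed b θ ^ 2 = sin θ ^ 2 + b ^ 2 * cos θ ^ 2 :=
  Real.sq_sqrt (by positivity)

theorem meridianSpeed_pos {b : ℝ} (hb : 0 < b) (θ : ℝ) : 0 < meridianSpeed b θ := by
  refine Real.sqrt_pos.2 ?_
  by_cases h : cos θ = 0
  · have := sin_sq_add_cos_sq θ
    rw [h] at this ⊢
    nlinarith
  · positivity

theorem eastVector_ellipsoidPoint (b φ : ℝ) {θ : ℝ} (hθ : 0 < cos θ) :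
    eastVector (ellipsoidPoint b φ θ) = !₂[-sin φ, cos φ, 0] := by
  have h : √((cos θ * cos φ) ^ 2 + (cos θ * sin φ) ^ 2) = cos θ := by
    rw [show (cos θ * cos φ) ^ 2 + (cos θ * sin φ) ^ 2 = cos θ ^ 2 by
      linear_combination cos θ ^ 2 * sin_sq_add_cos_sq φ, Real.sqrt_sq hθ.le]
  have h0 := hθ.ne'
  ext i
  fin_cases i <;> simp [eastVector, ellipsoidPoint, h] <;> field_simp

theorem unitNormal_ellipsoidPoint {b : ℝ} (hb : 0 < b) (φ θ : ℝ) :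
    unitNormal b (ellipsoidPoint b φ θ) = !₂[b * cos θ * cos φ / meridianSpeed b θ,
      b * cos θ * sin φ / meridianSpeed b θ, sin θ / meridianSpeed b θ] := by
  have hr := meridianSpeed_pos hb θ
  have h : ‖conormal b (ellipsoidPoint b φ θ)‖ = meridianSpeed b θ / b := by
    rw [← sq_eq_sq₀ (norm_nonneg _) (by positivity), div_pow, meridianSpeed_sq,
      EuclideanSpace.norm_sq_eq, Fin.sum_univ_three]
    simp only [Real.norm_eq_abs, sq_abs]
    simp [conormal, ellipsoidPoint]
    field_simp
    linear_combination b ^ 2 * cos θ ^ 2 * sin_sq_add_cos_sq φ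
  ext i
  fin_cases i <;> simp [unitNormal, h] <;> simp [conormal, ellipsoidPoint] <;> field_simp

/-- The unit vector field pointing north. -/
def northVector (b : ℝ) (x : E3) : E3 := rotPerp b x (eastVector x)

theorem northVector_ellipsoidPoint {b : ℝ} (hb : 0 < b) (φ : ℝ) {θ : ℝ} (hθ : 0 < cos θ) :
    northVector b (ellipsoidPoint b φ θ) = !₂[-sin θ * cos φ / meridianSpeed b θ,
      -sin θ * sin φ / meridianSpeed b θ, b * cos θ / meridianSpeed b θ] := by
  have hr := meridianSpeed_pos hb θ
  have hs := sin_sq_add_cos_sq φ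
  unfold northVector rotPerp
  rw [eastVector_ellipsoidPoint b φ hθ, unitNormal_ellipsoidPoint hb]
  ext i
  fin_cases i <;> simp [cross_apply]
  · ring
  · ring
  · field_simp
    linear_combination hs

theorem inner_east_self (b φ : ℝ) {θ : ℝ} (hθ : 0 < cos θ) :
    inner ℝ (eastVector (ellipsoidPoint b φ θ)) (eastVector (ellipsoidPoint b φ θ)) = (1 : ℝ) := by
  rw [eastVector_ellipsoidPoint b φ hθ, PiLp.inner_apply, Fin.sum_univ_three]
  simp

theorem norm_unitNormal_ellipsoidPoint {b : ℝ} (hb : 0 < b) (φ θ : ℝ) :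
    ‖unitNormal b (ellipsoidPoint b φ θ)‖ = 1 := by
  have hr := meridianSpeed_pos hb θ
  rw [← sq_eq_sq₀ (norm_nonneg _) zero_le_one, EuclideanSpace.norm_sq_eq, Fin.sum_univ_three,
    unitNormal_ellipsoidPoint hb]
  have := meridianSpeed_sq b θ
  simp only [Real.norm_eq_abs, sq_abs]
  simp
  field_simp
  linear_combination -this + b ^ 2 * cos θ ^ 2 * sin_sq_add_cos_sq φ

theorem inner_unitNormal_east {b : ℝ} (hb : 0 < b) (φ : ℝ) {θ : ℝ} (hθ : 0 < cos θ) :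
    inner ℝ (unitNormal b (ellipsoidPoint b φ θ)) (eastVector (ellipsoidPoint b φ θ))
      = (0 : ℝ) := by
  rw [eastVector_ellipsoidPoint b φ hθ, unitNormal_ellipsoidPoint hb]
  simp [PiLp.inner_apply, Fin.sum_univ_three]
  ring

/-- Away from the poles, normal, east and north form an orthonormal basis of space, so the
tangential part of a vector is the sum of its east and north components. -/
theorem frame_decomposition {b : ℝ} (hb : 0 < b) (φ : ℝ) {θ : ℝ} (hθ : 0 < cos θ) (v : E3) :
    v - inner ℝ (unitNormal b (ellipsoidPoint b φ θ)) v • unitNormal b (ellipsoidPoint b φ θ) =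
      inner ℝ (eastVector (ellipsoidPoint b φ θ)) v • eastVector (ellipsoidPoint b φ θ) +
      inner ℝ (northVector b (ellipsoidPoint b φ θ)) v •
        northVector b (ellipsoidPoint b φ θ) := by
  have hr := meridianSpeed_pos hb θ
  have h1 := meridianSpeed_sq b θ
  have h2 := sin_sq_add_cos_sq φ
  rw [eastVector_ellipsoidPoint b φ hθ, unitNormal_ellipsoidPoint hb,
    northVector_ellipsoidPoint hb φ hθ]
  ext i
  fin_cases i <;> simp [PiLp.inner_apply, Fin.sum_univ_three] <;> field_simp
  · linear_combination (cos φ ^ 2 * v 0 + cos φ * sin φ * v 1) * h1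
      - meridianSpeed b θ ^ 2 * v 0 * h2
  · linear_combination (sin φ ^ 2 * v 1 + cos φ * sin φ * v 0) * h1
      - meridianSpeed b θ ^ 2 * v 1 * h2
  · linear_combination v 2 * h1

theorem inner_unitNormal_rotPerp (b : ℝ) (x v : E3) :
    inner ℝ (unitNormal b x) (rotPerp b x v) = (0 : ℝ) := by
  simp [rotPerp, PiLp.inner_apply, Fin.sum_univ_three, cross_apply]
  ring

theorem rotPerp_rotPerp (b : ℝ) (x v : E3) :
    rotPerp b x (rotPerp b x v) =
      (inner ℝ (unitNormal b x) v : ℝ) • unitNormal b x - ‖unitNormal b x‖ ^ 2 • v := by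
  rw [EuclideanSpace.norm_sq_eq]
  ext i
  fin_cases i <;>
    simp [rotPerp, PiLp.inner_apply, Fin.sum_univ_three, cross_apply] <;> ring

theorem rotPerp_smul (b : ℝ) (x : E3) (c : ℝ) (v : E3) :
    rotPerp b x (c • v) = c • rotPerp b x v := by
  simp [rotPerp]

theorem rotPerp_northVector {b : ℝ} (hb : 0 < b) (φ : ℝ) {θ : ℝ} (hθ : 0 < cos θ) :
    rotPerp b (ellipsoidPoint b φ θ) (northVector b (ellipsoidPoint b φ θ)) =
      -eastVector (ellipsoidPoint b φ θ) := by
  rw [northVector, rotPerp_rotPerp, inner_unitNormal_east hb φ hθ,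
    norm_unitNormal_ellipsoidPoint hb]
  simp

/-! ### The surface measure as a product measure -/

/-- A property of all points of the ellipsoid other than the poles holds almost everywhere. -/
theorem ae_surfaceMeasure_of_forall {b : ℝ} {P : E3 → Prop}
    (h : ∀ φ θ, θ ∈ Ioo (-(π / 2)) (π / 2) → P (ellipsoidPoint b φ θ)) :
    ∀ᵐ x ∂(surfaceMeasure b), P x := by
  have hK : IsCompact ((fun p : ℝ × ℝ => ellipsoidPoint b p.1 p.2) ''
      (Icc (-π) π ×ˢ Icc (-(π / 2)) (π / 2))) :=
    (isCompact_Icc.prod isCompact_Icc).image (continuous_ellipsoidPoint b)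
  have hZ : MeasurableSet {x : E3 | x 0 = 0 ∧ x 1 = 0} := by
    refine MeasurableSet.inter ?_ ?_ <;> exact measurableSet_eq_fun (by fun_prop) (by fun_prop)
  -- `P` need not be measurable, so the transfer through the parametrization is done for a
  -- measurable set of full measure: the compact image of the closed rectangle without the axis. On
  -- the axis cos θ = 0, and the area density vanishes.
  have hT : ∀ᵐ x ∂(surfaceMeasure b), x ∈ ((fun p : ℝ × ℝ => ellipsoidPoint b p.1 p.2) ''
      (Icc (-π) π ×ˢ Icc (-(π / 2)) (π / 2))) \ {x : E3 | x 0 = 0 ∧ x 1 = 0} := by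
    unfold surfaceMeasure
    refine (ae_map_iff (continuous_ellipsoidPoint b).aemeasurable
      (hK.measurableSet.diff hZ)).2 ?_
    unfold coordArea
    rw [ae_withDensity_iff (by fun_prop)]
    refine (ae_restrict_iff' (measurableSet_Ico.prod measurableSet_Icc)).2 (ae_of_all _ ?_)
    refine fun p hp hd => ⟨mem_image_of_mem _ ⟨Ico_subset_Icc_self hp.1, hp.2⟩, ?_⟩
    rintro ⟨h0, h1⟩
    have h0' : cos p.2 * cos p.1 = 0 := by simpa [ellipsoidPoint] using h0
    have h1' : cos p.2 * sin p.1 = 0 := by simpa [ellipsoidPoint] using h1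
    refine hd ?_
    have : cos p.2 ^ 2 = 0 := by
      linear_combination (-cos p.2 ^ 2) * sin_sq_add_cos_sq p.1 + (cos p.2 * cos p.1) * h0'
        + (cos p.2 * sin p.1) * h1'
    simp [pow_eq_zero_iff two_ne_zero |>.1 this]
  filter_upwards [hT]
  rintro _ ⟨⟨p, ⟨-, hp⟩, rfl⟩, hx⟩
  refine h _ _ ⟨lt_of_le_of_ne hp.1 ?_, lt_of_le_of_ne hp.2 ?_⟩ <;> intro h0
  · exact hx (by simp [ellipsoidPoint, ← h0])
  · exact hx (by simp [ellipsoidPoint, h0])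

/-- The uniform probability measure on longitudes. -/
def lonMeasure : Measure ℝ := (ENNReal.ofReal (2 * π))⁻¹ • volume.restrict (Ico (-π) π)

/-- The distribution of the surface measure over latitudes. -/
def latMeasure (b : ℝ) : Measure ℝ :=
  (volume.restrict (Icc (-(π / 2)) (π / 2))).withDensity fun θ =>
    ENNReal.ofReal (2 * π) * ENNReal.ofReal (cos θ * √(sin θ ^ 2 + b ^ 2 * cos θ ^ 2))

theorem ofReal_two_pi_ne_zero : ENNReal.ofReal (2 * π) ≠ 0 := by
  simp [Real.pi_pos]

instance isProbabilityMeasure_lonMeasure : IsProbabilityMeasure lonMeasure := by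
  constructor
  simp only [lonMeasure, Measure.smul_apply, Measure.restrict_apply MeasurableSet.univ,
    univ_inter, Real.volume_Ico, smul_eq_mul]
  rw [show π - -π = 2 * π by ring]
  exact ENNReal.inv_mul_cancel ofReal_two_pi_ne_zero ENNReal.ofReal_ne_top

instance sFinite_latMeasure (b : ℝ) : SFinite (latMeasure b) := by
  unfold latMeasure; infer_instance

/-- The area density depends on θ only. Moving the factor 2π into the latitude measure makes the
longitude factor a probability measure, so that the zonal mean is an expectation. -/
theorem coordArea_eq_prod (b : ℝ) : coordArea b = lonMeasure.prod (latMeasure b) := by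
  unfold lonMeasure latMeasure coordArea
  rw [prod_withDensity_right (by fun_prop), Measure.prod_smul_left, Measure.prod_restrict,
    ← Measure.volume_eq_prod]
  have h : Measurable fun p : ℝ × ℝ =>
      ENNReal.ofReal (cos p.2 * √(sin p.2 ^ 2 + b ^ 2 * cos p.2 ^ 2)) := by fun_prop
  rw [withDensity_smul_measure]
  have := withDensity_smul (μ := volume.restrict (Ico (-π) π ×ˢ Icc (-(π / 2)) (π / 2)))
    (ENNReal.ofReal (2 * π)) h
  simp only [Pi.smul_def, smul_eq_mul] at this
  rw [this, smul_smul, ENNReal.inv_mul_cancel ofReal_two_pi_ne_zero ENNReal.ofReal_ne_top,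
    one_smul]

theorem surfaceMeasure_eq_map (b : ℝ) : surfaceMeasure b =
    (lonMeasure.prod (latMeasure b)).map fun p => ellipsoidPoint b p.1 p.2 := by
  rw [surfaceMeasure, coordArea_eq_prod]

theorem ae_coordArea_of_ae_surface {b : ℝ} {P : E3 → Prop} (h : ∀ᵐ x ∂(surfaceMeasure b), P x) :
    ∀ᵐ p ∂(coordArea b), P (ellipsoidPoint b p.1 p.2) :=
  ae_of_ae_map (continuous_ellipsoidPoint b).aemeasurable h

theorem ae_latMeasure_mem (b : ℝ) : ∀ᵐ θ ∂(latMeasure b), θ ∈ Ioo (-(π / 2)) (π / 2) := by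
  unfold latMeasure
  refine (withDensity_absolutelyContinuous _ _).ae_le ?_
  rw [← restrict_Ioo_eq_restrict_Icc]
  exact ae_restrict_mem measurableSet_Ioo

theorem ae_coordArea_mem (b : ℝ) : ∀ᵐ p ∂(coordArea b), p.2 ∈ Ioo (-(π / 2)) (π / 2) := by
  rw [coordArea_eq_prod]
  exact Measure.quasiMeasurePreserving_snd.ae (ae_latMeasure_mem b)

/-- The density of the latitude measure is positive between the poles, so its null sets there are
Lebesgue null. -/
theorem ae_restrict_of_ae_latMeasure {b : ℝ} (hb : 0 < b) {P : ℝ → Prop}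
    (h : ∀ᵐ θ ∂(latMeasure b), P θ) : ∀ᵐ θ ∂(volume.restrict (Icc (-(π / 2)) (π / 2))), P θ := by
  unfold latMeasure at h
  rw [ae_withDensity_iff (by fun_prop)] at h
  rw [← restrict_Ioo_eq_restrict_Icc] at h ⊢
  filter_upwards [h, ae_restrict_mem measurableSet_Ioo] with θ h1 h2
  refine h1 (mul_ne_zero ofReal_two_pi_ne_zero ?_)
  have := mul_pos (cos_pos_of_mem h2) (meridianSpeed_pos hb θ)
  simpa [meridianSpeed] using this

theorem ae_ae_slice {b : ℝ} {P : E3 → Prop} (h : ∀ᵐ x ∂(surfaceMeasure b), P x) :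
    ∀ᵐ θ ∂(latMeasure b), ∀ᵐ φ ∂lonMeasure, P (ellipsoidPoint b φ θ) := by
  have := ae_coordArea_of_ae_surface h
  rw [coordArea_eq_prod] at this
  exact Measure.ae_ae_of_ae_prod ((Measure.measurePreserving_swap (μ := latMeasure b)
    (ν := lonMeasure)).quasiMeasurePreserving.ae this)

/-- The latitude of a point of the ellipsoid. -/
def latitude (b : ℝ) (x : E3) : ℝ := arcsin (x 2 / b)

theorem measurable_latitude (b : ℝ) : Measurable (latitude b) := by
  unfold latitude
  exact measurable_arcsin.comp (by fun_prop)

theorem latitude_ellipsoidPoint {b : ℝ} (hb : 0 < b) (φ : ℝ) {θ : ℝ}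
    (hθ : θ ∈ Ioo (-(π / 2)) (π / 2)) : latitude b (ellipsoidPoint b φ θ) = θ := by
  simp [latitude, ellipsoidPoint, hb.ne', arcsin_sin hθ.1.le hθ.2.le]

theorem ae_surface_of_ae_lat {b : ℝ} (hb : 0 < b) {P : ℝ → Prop}
    (h : ∀ᵐ θ ∂(latMeasure b), P θ) : ∀ᵐ x ∂(surfaceMeasure b), P (latitude b x) := by
  -- The exceptional latitudes are enlarged to a measurable null set, so that the pull-back to the
  -- surface is measurable.
  obtain ⟨N, hN, hNm, hN0⟩ := exists_measurable_superset_of_null (ae_iff.1 h)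
  have : ∀ᵐ x ∂(surfaceMeasure b), latitude b x ∉ N := by
    refine (ae_map_iff (continuous_ellipsoidPoint b).aemeasurable
      ((measurable_latitude b hNm).compl)).2 ?_
    have h1 : ∀ᵐ p ∂(coordArea b), p.2 ∉ N := by
      rw [coordArea_eq_prod]
      exact Measure.quasiMeasurePreserving_snd.ae (measure_eq_zero_iff_ae_notMem.1 hN0)
    filter_upwards [h1, ae_coordArea_mem b] with p h1 h2
    simpa only [mem_preimage, latitude_ellipsoidPoint hb _ h2] using h1
  filter_upwards [this] with x hx
  by_contra h'
  exact hx (hN h')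

theorem zonalMean_eq_integral (b θ : ℝ) (h : E3 → ℝ) :
    zonalMean b θ h = ∫ φ, h (ellipsoidPoint b φ θ) ∂lonMeasure := by
  unfold zonalMean lonMeasure
  rw [intervalIntegral.integral_of_le (by linarith [Real.pi_pos]), integral_smul_measure,
    integral_Ico_eq_integral_Ioc, smul_eq_mul, ENNReal.toReal_inv,
    ENNReal.toReal_ofReal (by positivity)]

theorem integrable_slice {b : ℝ} {h : E3 → ℝ} (hh : Integrable h (surfaceMeasure b)) :
    ∀ᵐ θ ∂(latMeasure b), Integrable (fun φ => h (ellipsoidPoint b φ θ)) lonMeasure := by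
  rw [surfaceMeasure_eq_map] at hh
  exact (hh.comp_aemeasurable (continuous_ellipsoidPoint b).aemeasurable).prod_left_ae

theorem integral_surface_eq {b : ℝ} {h : E3 → ℝ} (hh : Integrable h (surfaceMeasure b)) :
    ∫ x, h x ∂(surfaceMeasure b) = ∫ θ, zonalMean b θ h ∂(latMeasure b) := by
  rw [surfaceMeasure_eq_map] at hh ⊢
  rw [integral_map (continuous_ellipsoidPoint b).aemeasurable hh.aestronglyMeasurable]
  simp only [zonalMean_eq_integral]
  exact integral_prod_symm _ (hh.comp_aemeasurable (continuous_ellipsoidPoint b).aemeasurable)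

/-! ### The zonal mean as an operator -/

/-- The zonal mean as a function on the ellipsoid. -/
def zonalLift (b : ℝ) (h : E3 → ℝ) (x : E3) : ℝ := zonalMean b (latitude b x) h

theorem zonalLift_ellipsoidPoint {b : ℝ} (hb : 0 < b) (h : E3 → ℝ) (φ : ℝ) {θ : ℝ}
    (hθ : θ ∈ Ioo (-(π / 2)) (π / 2)) :
    zonalLift b h (ellipsoidPoint b φ θ) = zonalMean b θ h := by
  rw [zonalLift, latitude_ellipsoidPoint hb φ hθ]

theorem measurable_zonalLift (b : ℝ) {h : E3 → ℝ} (hh : Measurable h) :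
    Measurable (zonalLift b h) := by
  have h1 : Measurable fun θ => zonalMean b θ h := by
    simp only [zonalMean_eq_integral]
    have h2 : StronglyMeasurable fun p : ℝ × ℝ => h (ellipsoidPoint b p.1 p.2) :=
      (hh.comp (continuous_ellipsoidPoint b).measurable).stronglyMeasurable
    exact h2.integral_prod_left'.measurable
  exact h1.comp (measurable_latitude b)

/-- On a probability space the L¹ norm is at most the L² norm. -/
theorem enorm_integral_sq_le {X : Type*} [MeasurableSpace X] {μ : Measure X}
    [IsProbabilityMeasure μ] {f : X → ℝ} (hf : AEStronglyMeasurable f μ) :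
    ‖∫ x, f x ∂μ‖ₑ ^ (2 : ℝ) ≤ ∫⁻ x, ‖f x‖ₑ ^ (2 : ℝ) ∂μ := by
  have h1 : ‖∫ x, f x ∂μ‖ₑ ≤ eLpNorm f 2 μ := by
    refine (enorm_integral_le_lintegral_enorm f).trans ?_
    rw [← eLpNorm_one_eq_lintegral_enorm]
    exact eLpNorm_le_eLpNorm_of_exponent_le (by norm_num) hf
  have h2 : eLpNorm f 2 μ ^ (2 : ℝ) = ∫⁻ x, ‖f x‖ₑ ^ (2 : ℝ) ∂μ := by
    have := eLpNorm_nnreal_pow_eq_lintegral (f := f) (μ := μ) (p := 2) (by norm_num)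
    simpa using this
  rw [← h2]
  gcongr

/-- Jensen's inequality on each circle, integrated over latitudes. -/
theorem eLpNorm_zonalLift_le {b : ℝ} (hb : 0 < b) {h : E3 → ℝ} (hh : Measurable h) :
    eLpNorm (zonalLift b h) 2 (surfaceMeasure b) ≤ eLpNorm h 2 (surfaceMeasure b) := by
  have hp := (continuous_ellipsoidPoint b).measurable
  have key : ∀ {g : E3 → ℝ}, Measurable g → eLpNorm g 2 (surfaceMeasure b) ^ (2 : ℝ) =
      ∫⁻ θ, ∫⁻ φ, ‖g (ellipsoidPoint b φ θ)‖ₑ ^ (2 : ℝ) ∂lonMeasure ∂(latMeasure b) := by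
    intro g hg
    have := eLpNorm_nnreal_pow_eq_lintegral (f := g) (μ := surfaceMeasure b) (p := 2) (by norm_num)
    rw [surfaceMeasure_eq_map, lintegral_map (by fun_prop) hp,
      lintegral_prod_symm _ (by fun_prop)] at this
    rw [surfaceMeasure_eq_map]
    simpa using this
  rw [← ENNReal.rpow_le_rpow_iff (z := 2) (by norm_num), key hh, key (measurable_zonalLift b hh)]
  refine lintegral_mono_ae ?_
  filter_upwards [ae_latMeasure_mem b] with θ hθ
  simp only [zonalLift_ellipsoidPoint hb h _ hθ, zonalMean_eq_integral, lintegral_const,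
    measure_univ, mul_one]
  exact enorm_integral_sq_le
    (hh.comp (hp.comp (measurable_id.prodMk measurable_const))).aestronglyMeasurable

theorem memLp_zonalLift {b : ℝ} (hb : 0 < b) {h : E3 → ℝ} (hm : Measurable h)
    (hh : MemLp h 2 (surfaceMeasure b)) : MemLp (zonalLift b h) 2 (surfaceMeasure b) :=
  ⟨(measurable_zonalLift b hm).aestronglyMeasurable,
    (eLpNorm_zonalLift_le hb hm).trans_lt hh.2⟩

/-- By Fubini, functions equal almost everywhere on the surface agree almost everywhere on almost
every circle. This makes the zonal mean independent of the L² representative. -/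
theorem zonalLift_congr_ae {b : ℝ} (hb : 0 < b) {g h : E3 → ℝ}
    (hgh : ∀ᵐ x ∂(surfaceMeasure b), g x = h x) :
    ∀ᵐ x ∂(surfaceMeasure b), zonalLift b g x = zonalLift b h x := by
  refine ae_surface_of_ae_lat hb (P := fun θ => zonalMean b θ g = zonalMean b θ h) ?_
  filter_upwards [ae_ae_slice hgh] with θ hθ
  simp only [zonalMean_eq_integral]
  exact integral_congr_ae hθ

theorem zonalLift_sub_ae {b : ℝ} (hb : 0 < b) {g h : E3 → ℝ}
    (hg : Integrable g (surfaceMeasure b)) (hh : Integrable h (surfaceMeasure b)) :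
    ∀ᵐ x ∂(surfaceMeasure b),
      zonalLift b (fun y => g y - h y) x = zonalLift b g x - zonalLift b h x := by
  refine ae_surface_of_ae_lat hb
    (P := fun θ => zonalMean b θ (fun y => g y - h y) = zonalMean b θ g - zonalMean b θ h) ?_
  filter_upwards [integrable_slice hg, integrable_slice hh] with θ h1 h2
  simp only [zonalMean_eq_integral]
  exact integral_sub h1 h2

/-- The zonal mean is a symmetric operator. -/
theorem integral_zonalLift_mul {b : ℝ} (hb : 0 < b) {g h : E3 → ℝ} (hgm : Measurable g)
    (hhm : Measurable h) (hg : MemLp g 2 (surfaceMeasure b)) (hh : MemLp h 2 (surfaceMeasure b)) :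
    ∫ x, zonalLift b g x * h x ∂(surfaceMeasure b) =
      ∫ x, g x * zonalLift b h x ∂(surfaceMeasure b) := by
  refine (integral_surface_eq ((memLp_zonalLift hb hgm hg).integrable_mul hh)).trans
    (Eq.trans ?_ (integral_surface_eq (hg.integrable_mul (memLp_zonalLift hb hhm hh))).symm)
  refine integral_congr_ae ?_
  filter_upwards [ae_latMeasure_mem b] with θ hθ
  simp only [zonalMean_eq_integral, Pi.mul_apply, zonalLift_ellipsoidPoint hb _ _ hθ,
    integral_const_mul, integral_mul_const]

/-! ### Measurability and integrability -/

theorem measurable_eastVector : Measurable eastVector := by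
  unfold eastVector
  have h : Measurable fun x : E3 => (√(x 0 ^ 2 + x 1 ^ 2))⁻¹ := by fun_prop
  refine h.smul ?_
  refine (PiLp.continuous_toLp 2 _).measurable.comp (measurable_pi_lambda _ fun i => ?_)
  fin_cases i <;> simp <;> fun_prop

theorem measurable_northVector (b : ℝ) : Measurable (northVector b) :=
  measurable_rotPerp measurable_eastVector

theorem norm_eastVector_le (x : E3) : ‖eastVector x‖ ≤ 1 := by
  unfold eastVector
  have h : ‖(!₂[-x 1, x 0, 0] : E3)‖ = √(x 0 ^ 2 + x 1 ^ 2) := by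
    rw [EuclideanSpace.norm_eq, Fin.sum_univ_three]
    simp [add_comm]
  rw [norm_smul, h, norm_inv, Real.norm_eq_abs, abs_of_nonneg (Real.sqrt_nonneg _)]
  exact inv_mul_le_one

theorem norm_northVector_le (b : ℝ) (x : E3) : ‖northVector b x‖ ≤ 1 :=
  (norm_rotPerp_le b x _).trans (norm_eastVector_le x)

theorem abs_inner_le_of_norm_le_one {e : E3} (he : ‖e‖ ≤ 1) (v : E3) :
    ‖(inner ℝ v e : ℝ)‖ ≤ ‖v‖ :=
  (norm_inner_le_norm v e).trans (mul_le_of_le_one_right (norm_nonneg _) he)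

theorem measurable_field {b : ℝ} (u : L2Field b) : Measurable (u : E3 → E3) :=
  (Lp.stronglyMeasurable u).measurable

theorem measurable_inner_field {u e : E3 → E3} (hu : Measurable u) (he : Measurable e) :
    Measurable fun x => (inner ℝ (u x) (e x) : ℝ) :=
  hu.inner he

theorem memLp_inner_field {b : ℝ} {u e : E3 → E3} (hum : Measurable u)
    (hu : MemLp u 2 (surfaceMeasure b)) (hem : Measurable e) (he : ∀ x, ‖e x‖ ≤ 1) :
    MemLp (fun x => (inner ℝ (u x) (e x) : ℝ)) 2 (surfaceMeasure b) :=
  hu.of_le (measurable_inner_field hum hem).aestronglyMeasurable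
    (ae_of_all _ fun x => abs_inner_le_of_norm_le_one (he x) (u x))

theorem memLp_smul_field {b : ℝ} {a : E3 → ℝ} {e : E3 → E3} (ham : Measurable a)
    (ha : MemLp a 2 (surfaceMeasure b)) (hem : Measurable e) (he : ∀ x, ‖e x‖ ≤ 1) :
    MemLp (fun x => a x • e x) 2 (surfaceMeasure b) :=
  ha.of_le (ham.smul hem).aestronglyMeasurable (ae_of_all _ fun x => by
    rw [norm_smul]
    exact mul_le_of_le_one_right (norm_nonneg _) (he x))

theorem norm_ellipsoidPoint_le (b φ θ : ℝ) : ‖ellipsoidPoint b φ θ‖ ≤ 1 + |b| := by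
  refine le_of_sq_le_sq ?_ (by positivity)
  rw [EuclideanSpace.norm_sq_eq, Fin.sum_univ_three]
  simp only [Real.norm_eq_abs, sq_abs]
  simp only [ellipsoidPoint, Matrix.cons_val_zero, Matrix.cons_val_one, Matrix.cons_val]
  have h1 := sin_sq_add_cos_sq φ
  have h2 := cos_sq_le_one θ
  have h3 := sin_sq_le_one θ
  have h4 : b ^ 2 * sin θ ^ 2 ≤ b ^ 2 := mul_le_of_le_one_right (sq_nonneg _) h3
  have h5 := sq_abs b
  nlinarith [abs_nonneg b]

theorem memLp_of_continuous (b : ℝ) {h : E3 → ℝ} (hh : Continuous h) :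
    MemLp h 2 (surfaceMeasure b) := by
  obtain ⟨C, hC⟩ := (isCompact_closedBall (0 : E3) (1 + |b|)).exists_bound_of_continuousOn
    hh.continuousOn
  refine MemLp.of_bound hh.aestronglyMeasurable C (ae_surfaceMeasure_of_forall fun φ θ _ => ?_)
  exact hC _ (by simpa using norm_ellipsoidPoint_le b φ θ)

/-! ### Derivatives along the ellipsoid -/

theorem inner_gradient_eq (f : E3 → ℝ) (x v : E3) : inner ℝ v (gradient f x) = fderiv ℝ f x v := by
  rw [real_inner_comm, gradient, InnerProductSpace.toDual_symm_apply]

theorem inner_surfGrad_eq {b : ℝ} (f : E3 → ℝ) {x v : E3}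
    (h : inner ℝ (unitNormal b x) v = (0 : ℝ)) :
    inner ℝ v (surfGrad b f x) = fderiv ℝ f x v := by
  rw [surfGrad, inner_sub_right, inner_smul_right, real_inner_comm (unitNormal b x) v, h, inner_gradient_eq,
    mul_zero, sub_zero]

theorem integrable_fderiv_apply {b : ℝ} {f : E3 → ℝ} (hf : ContDiff ℝ ∞ f) {u : L2Field b}
    (hu : IsTangent b u) : Integrable (fun x => fderiv ℝ f x (u x)) (surfaceMeasure b) := by
  have h := L2.integrable_inner (𝕜 := ℝ) u ((memLp_surfGrad b hf).toLp _)
  refine h.congr ?_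
  filter_upwards [hu, (memLp_surfGrad b hf).coeFn_toLp] with x h1 h2
  rw [h2, inner_surfGrad_eq f h1]

theorem integrable_coriolis_mul_fderiv_apply {b : ℝ} {f : E3 → ℝ} (hf : ContDiff ℝ ∞ f)
    {u : L2Field b} (hu : IsTangent b u) :
    Integrable (fun x => coriolis b x * fderiv ℝ f x (u x)) (surfaceMeasure b) :=
  (integrable_fderiv_apply hf hu).bdd_mul (measurable_coriolis b).aestronglyMeasurable
    (ae_of_all _ (abs_coriolis_le b))

/-- Working form of membership: div v = 0 and div(c v) = 0, tested with ambient derivatives, which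
agree with surface derivatives along tangent vectors. The second condition holds because applying
the rotation to both arguments preserves the inner product on tangent vectors. -/
theorem mem_nullL_iff {b : ℝ} {v : L2Field b} : v ∈ nullL b ↔ IsTangent b v ∧
    (∀ f : E3 → ℝ, ContDiff ℝ ∞ f → ∫ x, fderiv ℝ f x (v x) ∂(surfaceMeasure b) = 0) ∧
    ∀ f : E3 → ℝ, ContDiff ℝ ∞ f →
      ∫ x, coriolis b x * fderiv ℝ f x (v x) ∂(surfaceMeasure b) = 0 := by
  have h0 : v ∈ nullL b ↔ IsDivFree b v ∧ IsCoriolisOp b v 0 := Iff.rfl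
  rw [h0, isCoriolisOp_zero_iff, IsDivFree, and_assoc]
  refine and_congr_right fun hv => and_congr ?_ ?_
  · refine forall₂_congr fun f _ => ?_
    rw [integral_congr_ae (hv.mono fun x hx => inner_surfGrad_eq f hx)]
  · refine forall₂_congr fun f _ => ?_
    rw [distribCurl, ← integral_neg]
    have : ∀ᵐ x ∂(surfaceMeasure b), -inner ℝ (coriolis b x • rotPerp b x (v x))
        (rotPerp b x (surfGrad b f x)) = -(coriolis b x * fderiv ℝ f x (v x)) := by
      filter_upwards [hv, ae_norm_unitNormal b] with x h1 h2
      rw [real_inner_smul_left, inner_rotPerp, rotPerp_rotPerp, h2, inner_sub_right,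
        inner_smul_right, real_inner_comm _ (v x), h1]
      simp [inner_surfGrad_eq f h1]
    rw [integral_congr_ae this, integral_neg, neg_eq_zero]

theorem hasDerivAt_ellipsoidPoint (b φ : ℝ) {θ : ℝ} (hθ : 0 < cos θ) :
    HasDerivAt (fun s => ellipsoidPoint b s θ) (cos θ • eastVector (ellipsoidPoint b φ θ)) φ := by
  have h := (((hasDerivAt_cos φ).smul_const (!₂[cos θ, 0, 0] : E3)).add
    ((hasDerivAt_sin φ).smul_const (!₂[0, cos θ, 0] : E3))).add_const (!₂[0, 0, b * sin θ] : E3)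
  rw [eastVector_ellipsoidPoint b φ hθ]
  have h1 : (fun s => ellipsoidPoint b s θ) = fun s =>
      cos s • (!₂[cos θ, 0, 0] : E3) + sin s • (!₂[0, cos θ, 0] : E3) + !₂[0, 0, b * sin θ] := by
    funext s
    ext i
    fin_cases i <;> simp [ellipsoidPoint, mul_comm]
  have h2 : cos θ • (!₂[-sin φ, cos φ, 0] : E3) =
      -sin φ • (!₂[cos θ, 0, 0] : E3) + cos φ • (!₂[0, cos θ, 0] : E3) := by
    ext i
    fin_cases i <;> simp [mul_comm]
  rw [h1, h2]
  exact h

theorem hasDerivAt_longitude {f : E3 → ℝ} (hf : ContDiff ℝ ∞ f) (b φ : ℝ) {θ : ℝ}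
    (hθ : 0 < cos θ) :
    HasDerivAt (fun s => f (ellipsoidPoint b s θ))
      (cos θ * fderiv ℝ f (ellipsoidPoint b φ θ) (eastVector (ellipsoidPoint b φ θ))) φ := by
  have h := (hf.differentiable (by simp) (ellipsoidPoint b φ θ)).hasFDerivAt.comp_hasDerivAt φ
    (hasDerivAt_ellipsoidPoint b φ hθ)
  rwa [map_smul, smul_eq_mul] at h

theorem ellipsoidPoint_add_two_pi (b φ θ : ℝ) :
    ellipsoidPoint b (φ + 2 * π) θ = ellipsoidPoint b φ θ := by
  simp [ellipsoidPoint]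

theorem intervalIntegral_shift_eq_zonalMean (b φ θ : ℝ) (h : E3 → ℝ) (a : ℝ) :
    ∫ α in a..(a + 2 * π), h (ellipsoidPoint b (φ + α) θ) = 2 * π * zonalMean b θ h := by
  have hper : Function.Periodic (fun s => h (ellipsoidPoint b s θ)) (2 * π) := fun s => by
    simp only [ellipsoidPoint_add_two_pi]
  rw [intervalIntegral.integral_comp_add_left (fun s => h (ellipsoidPoint b s θ)), ← add_assoc,
    hper.intervalIntegral_add_eq _ (-π), zonalMean, show -π + 2 * π = π by ring]
  field_simp

theorem axialRotation_eastVector (b α φ : ℝ) {θ : ℝ} (hθ : 0 < cos θ) :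
    axialRotation α (eastVector (ellipsoidPoint b φ θ)) =
      eastVector (ellipsoidPoint b (φ + α) θ) := by
  rw [eastVector_ellipsoidPoint b φ hθ, eastVector_ellipsoidPoint b _ hθ]
  ext i
  fin_cases i <;> simp [axialRotation, cos_add, sin_add] <;> ring

theorem axialRotation_northVector {b : ℝ} (hb : 0 < b) (α φ : ℝ) {θ : ℝ} (hθ : 0 < cos θ) :
    axialRotation α (northVector b (ellipsoidPoint b φ θ)) =
      northVector b (ellipsoidPoint b (φ + α) θ) := by
  rw [northVector_ellipsoidPoint hb φ hθ, northVector_ellipsoidPoint hb _ hθ]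
  ext i
  fin_cases i <;> simp [axialRotation, cos_add, sin_add] <;> ring

theorem continuous_longitude_deriv {f : E3 → ℝ} (hf : ContDiff ℝ ∞ f) (b φ : ℝ) {θ : ℝ}
    (hθ : 0 < cos θ) : Continuous fun α =>
      fderiv ℝ f (ellipsoidPoint b (φ + α) θ) (eastVector (ellipsoidPoint b (φ + α) θ)) := by
  have h1 : Continuous fun α : ℝ => ellipsoidPoint b (φ + α) θ :=
    (continuous_ellipsoidPoint b).comp (by fun_prop : Continuous fun α : ℝ => (φ + α, θ))
  refine ((hf.continuous_fderiv (by simp)).comp h1).clm_apply ?_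
  simp only [eastVector_ellipsoidPoint b _ hθ]
  refine (PiLp.continuous_toLp 2 _).comp (continuous_pi fun i => ?_)
  fin_cases i <;> simp <;> fun_prop

/-- The deviation of a smooth function from its zonal mean is a longitudinal derivative of a
smooth function. -/
theorem fderiv_axialMean_id {g : E3 → ℝ} (hg : ContDiff ℝ ∞ g) (b φ : ℝ) {θ : ℝ}
    (hθ : 0 < cos θ) :
    cos θ * fderiv ℝ (axialMean id g 0 (2 * π)) (ellipsoidPoint b φ θ)
      (eastVector (ellipsoidPoint b φ θ)) =
        2 * π * (g (ellipsoidPoint b φ θ) - zonalMean b θ g) := by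
  rw [fderiv_axialMean contDiff_id hg, ← intervalIntegral.integral_const_mul]
  simp only [axialRotation_ellipsoidPoint, axialRotation_eastVector b _ φ hθ, id]
  have hv : ∀ α : ℝ, HasDerivAt (fun α => g (ellipsoidPoint b (φ + α) θ))
      (cos θ * fderiv ℝ g (ellipsoidPoint b (φ + α) θ)
        (eastVector (ellipsoidPoint b (φ + α) θ))) α := fun α => by
    have := (hasDerivAt_longitude hg b (φ + α) hθ).comp_const_add φ α
    exact this
  have hc := (continuous_longitude_deriv hg b φ hθ).const_mul (cos θ)
  -- Integration by parts with weight α: the boundary term is 2π g at the starting point, since the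
  -- weight vanishes at 0 and a full turn returns to that point; the other term is the integral of g
  -- over the circle.
  have key := intervalIntegral.integral_mul_deriv_eq_deriv_mul (a := 0) (b := 2 * π)
    (u := fun α => α) (u' := fun _ => 1) (fun α _ => hasDerivAt_id α) (fun α _ => hv α)
    intervalIntegrable_const (hc.intervalIntegrable _ _)
  have hz := intervalIntegral_shift_eq_zonalMean b φ θ g 0
  simp only [zero_add] at hz
  simp only [one_mul, hz, ellipsoidPoint_add_two_pi] at key
  calc _ = _ := intervalIntegral.integral_congr fun α _ => by ring
    _ = _ := key
    _ = _ := by ring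

/-- The integrand is, up to the factor cos θ, the derivative of a periodic function of longitude. -/
theorem zonalMean_fderiv_eastVector {f : E3 → ℝ} (hf : ContDiff ℝ ∞ f) (b : ℝ) {θ : ℝ}
    (hθ : 0 < cos θ) : zonalMean b θ (fun x => fderiv ℝ f x (eastVector x)) = 0 := by
  have hc := (continuous_longitude_deriv hf b 0 hθ).const_mul (cos θ)
  simp only [zero_add] at hc
  have h := intervalIntegral.integral_eq_sub_of_hasDerivAt (a := -π) (b := π)
    (fun φ _ => hasDerivAt_longitude hf b φ hθ) (hc.intervalIntegrable _ _)
  have h2 := ellipsoidPoint_add_two_pi b (-π) θ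
  rw [show -π + 2 * π = π by ring] at h2
  rw [h2, sub_self, intervalIntegral.integral_const_mul, mul_eq_zero] at h
  rw [zonalMean, h.resolve_left hθ.ne', mul_zero]

/-! ### Zonal fields lie in the null space -/

theorem isTangent_of_ae_eq_smul_east {b : ℝ} (hb : 0 < b) {A : L2Field b} {a : E3 → ℝ}
    (hA : ∀ᵐ x ∂(surfaceMeasure b), A x = a x • eastVector x) : IsTangent b A := by
  have h : ∀ᵐ x ∂(surfaceMeasure b), inner ℝ (unitNormal b x) (eastVector x) = (0 : ℝ) :=
    ae_surfaceMeasure_of_forall fun φ θ hθ => inner_unitNormal_east hb φ (cos_pos_of_mem hθ)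
  unfold IsTangent
  filter_upwards [hA, h] with x h1 h2
  rw [h1, inner_smul_right, h2, mul_zero]

/-- On each circle the weight and the coefficient of `A` are constant, which leaves the mean of an
eastward derivative. The weights needed are 1 and the Coriolis profile. -/
theorem integral_zonal_mul_fderiv_eq_zero {b : ℝ} (hb : 0 < b) {A : L2Field b} {g : E3 → ℝ}
    (hA : ∀ᵐ x ∂(surfaceMeasure b), A x = zonalLift b g x • eastVector x)
    {k : E3 → ℝ} {κ : ℝ → ℝ} (hk : ∀ φ θ, k (ellipsoidPoint b φ θ) = κ θ)
    {f : E3 → ℝ} (hf : ContDiff ℝ ∞ f)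
    (hi : Integrable (fun x => k x * fderiv ℝ f x (A x)) (surfaceMeasure b)) :
    ∫ x, k x * fderiv ℝ f x (A x) ∂(surfaceMeasure b) = 0 := by
  have h1 : ∀ᵐ x ∂(surfaceMeasure b), k x * fderiv ℝ f x (A x) =
      k x * (zonalLift b g x * fderiv ℝ f x (eastVector x)) := by
    filter_upwards [hA] with x hx
    rw [hx, map_smul, smul_eq_mul]
  rw [integral_congr_ae h1, integral_surface_eq (hi.congr h1)]
  refine integral_eq_zero_of_ae ?_
  filter_upwards [ae_latMeasure_mem b] with θ hθ
  have h2 := zonalMean_fderiv_eastVector hf b (cos_pos_of_mem hθ)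
  simp only [zonalMean_eq_integral, hk, zonalLift_ellipsoidPoint hb _ _ hθ,
    integral_const_mul] at h2 ⊢
  simp [h2]

theorem zonal_field_mem_nullL {b : ℝ} (hb : 0 < b) {A : L2Field b} {g : E3 → ℝ}
    (hA : ∀ᵐ x ∂(surfaceMeasure b), A x = zonalLift b g x • eastVector x) : A ∈ nullL b := by
  have hT := isTangent_of_ae_eq_smul_east hb hA
  refine mem_nullL_iff.2 ⟨hT, fun f hf => ?_, fun f hf => ?_⟩
  · have := integral_zonal_mul_fderiv_eq_zero hb hA (k := fun _ => 1) (κ := fun _ => 1)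
      (fun _ _ => rfl) hf (by simpa using integrable_fderiv_apply hf hT)
    simpa using this
  · exact integral_zonal_mul_fderiv_eq_zero hb hA (coriolis_ellipsoidPoint hb) hf
      (integrable_coriolis_mul_fderiv_apply hf hT)

/-! ### Fields in the null space are zonal -/

/-- A smooth function on space that agrees with the Coriolis profile on the ellipsoid. -/
def smoothCoriolis (b : ℝ) (x : E3) : ℝ :=
  -2 * (x 2 / b) / √(b ^ 2 + (1 - b ^ 2) * (x 2 / b) ^ 2)

section

variable {b : ℝ}

/-- Replacing cos² θ by 1 - sin² θ makes the radicand positive on all of space when b < 1, so the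
extended profile is smooth everywhere and can multiply test functions. -/
theorem smoothCoriolis_radicand_pos (hb0 : 0 < b) (hb1 : b < 1) (t : ℝ) :
    0 < b ^ 2 + (1 - b ^ 2) * t ^ 2 := by
  have : 0 < 1 - b ^ 2 := by nlinarith
  positivity

theorem contDiff_smoothCoriolis (hb0 : 0 < b) (hb1 : b < 1) :
    ContDiff ℝ ∞ (smoothCoriolis b) := by
  have h : ContDiff ℝ ∞ fun x : E3 => x 2 := by fun_prop
  unfold smoothCoriolis
  refine (contDiff_const.mul (h.div_const b)).div (ContDiff.sqrt ?_ fun x =>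
    (smoothCoriolis_radicand_pos hb0 hb1 _).ne') fun x =>
    (Real.sqrt_pos.2 (smoothCoriolis_radicand_pos hb0 hb1 _)).ne'
  exact contDiff_const.add (contDiff_const.mul ((h.div_const b).pow 2))

theorem smoothCoriolis_ellipsoidPoint (hb0 : 0 < b) (φ θ : ℝ) :
    smoothCoriolis b (ellipsoidPoint b φ θ) = coriolis b (ellipsoidPoint b φ θ) := by
  rw [coriolis_ellipsoidPoint hb0]
  have h : ellipsoidPoint b φ θ 2 / b = sin θ := by
    simp [ellipsoidPoint, hb0.ne']
  have h2 : b ^ 2 + (1 - b ^ 2) * sin θ ^ 2 = sin θ ^ 2 + b ^ 2 * cos θ ^ 2 := by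
    linear_combination -b ^ 2 * sin_sq_add_cos_sq θ
  rw [smoothCoriolis, h, h2]

/-- With t = z/b and D the radicand, the profile has t-derivative -2b²/D^(3/2), which never
vanishes: only horizontal directions leave it stationary. -/
theorem fderiv_smoothCoriolis (hb0 : 0 < b) (hb1 : b < 1) (x : E3) :
    ∃ c : ℝ, c ≠ 0 ∧ ∀ v : E3, fderiv ℝ (smoothCoriolis b) x v = c * v 2 := by
  set t := x 2 / b with ht
  set D := b ^ 2 + (1 - b ^ 2) * t ^ 2 with hD
  have hDpos : 0 < D := smoothCoriolis_radicand_pos hb0 hb1 t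
  have hs : 0 < √D := Real.sqrt_pos.2 hDpos
  have h1 : HasDerivAt (fun s => -2 * s / √(b ^ 2 + (1 - b ^ 2) * s ^ 2))
      (-2 * b ^ 2 / (D * √D)) t := by
    have hr : HasDerivAt (fun s => b ^ 2 + (1 - b ^ 2) * s ^ 2) ((1 - b ^ 2) * (2 * t)) t := by
      simpa using (((hasDerivAt_id t).pow 2).const_mul (1 - b ^ 2)).const_add (b ^ 2)
    have h := ((hasDerivAt_id t).const_mul (-2)).div (hr.sqrt hDpos.ne') hs.ne'
    refine h.congr_deriv ?_
    rw [← hD, Real.sq_sqrt hDpos.le, id]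
    have hsq := Real.sq_sqrt hDpos.le
    field_simp
    rw [hsq, hD]
    ring
  have h2 : HasFDerivAt (fun y : E3 => y 2 / b)
      (b⁻¹ • (EuclideanSpace.proj 2 : E3 →L[ℝ] ℝ)) x := by
    have := (EuclideanSpace.proj 2 : E3 →L[ℝ] ℝ).hasFDerivAt (x := x) |>.const_smul b⁻¹
    refine this.congr_of_eventuallyEq (Eventually.of_forall fun y => ?_)
    simp [div_eq_inv_mul]
  have h3 : HasFDerivAt (smoothCoriolis b)
      ((-2 * b ^ 2 / (D * √D)) • b⁻¹ • (EuclideanSpace.proj 2 : E3 →L[ℝ] ℝ)) x :=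
    HasDerivAt.comp_hasFDerivAt (h₂ := fun s => -2 * s / √(b ^ 2 + (1 - b ^ 2) * s ^ 2)) x h1 h2
  refine ⟨-2 * b ^ 2 / (D * √D) * b⁻¹, ?_, fun v => ?_⟩
  · have : b ≠ 0 := hb0.ne'
    positivity
  · rw [h3.fderiv]
    simp [mul_assoc]

/-- Leibniz rule: f (v · ∇c) = v · ∇(c f) - c (v · ∇f). The two terms integrate to zero by div v = 0
tested on c f and div(c v) = 0 tested on f. As f is arbitrary, v · ∇c = 0. -/
theorem third_component_eq_zero (hb0 : 0 < b) (hb1 : b < 1) {v : L2Field b} (hv : v ∈ nullL b) :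
    ∀ᵐ x ∂(surfaceMeasure b), v x 2 = 0 := by
  obtain ⟨hT, h1, h2⟩ := mem_nullL_iff.1 hv
  have hc := contDiff_smoothCoriolis hb0 hb1
  have hci := integrable_fderiv_apply hc hT
  have hz : ∀ᵐ x ∂(surfaceMeasure b), fderiv ℝ (smoothCoriolis b) x (v x) = 0 := by
    refine ae_eq_zero_of_integral_contDiff_smul_eq_zero hci.locallyIntegrable fun f hf _ => ?_
    have hp : ∀ᵐ x ∂(surfaceMeasure b), f x • fderiv ℝ (smoothCoriolis b) x (v x) =
        fderiv ℝ (fun y => smoothCoriolis b y * f y) x (v x) -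
          coriolis b x * fderiv ℝ f x (v x) := by
      have he : ∀ᵐ x ∂(surfaceMeasure b), smoothCoriolis b x = coriolis b x :=
        ae_surfaceMeasure_of_forall fun φ θ _ => smoothCoriolis_ellipsoidPoint hb0 φ θ
      filter_upwards [he] with x hx
      rw [fderiv_fun_mul (hc.differentiable (by simp) x) (hf.differentiable (by simp) x)]
      simp [hx]
    rw [integral_congr_ae hp, integral_sub (integrable_fderiv_apply (hc.mul hf) hT)
      (integrable_coriolis_mul_fderiv_apply hf hT), h1 _ (hc.mul hf), h2 _ hf, sub_zero]
  filter_upwards [hz] with x hx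
  obtain ⟨c, hc0, hc⟩ := fderiv_smoothCoriolis hb0 hb1 x
  rw [hc] at hx
  exact (mul_eq_zero.1 hx).resolve_left hc0

/-- Off the poles the north vector has nonzero third component and the east vector has none, so a
horizontal tangent vector has no northward part. -/
theorem nullL_eq_smul_east (hb0 : 0 < b) (hb1 : b < 1) {v : L2Field b} (hv : v ∈ nullL b) :
    ∀ᵐ x ∂(surfaceMeasure b), v x = (inner ℝ (v x) (eastVector x) : ℝ) • eastVector x := by
  have h : ∀ᵐ x ∂(surfaceMeasure b), ∀ w : E3, inner ℝ (unitNormal b x) w = (0 : ℝ) → w 2 = 0 →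
      w = (inner ℝ w (eastVector x) : ℝ) • eastVector x := by
    refine ae_surfaceMeasure_of_forall fun φ θ hθ w hw hw2 => ?_
    have hc := cos_pos_of_mem hθ
    have hr := meridianSpeed_pos hb0 θ
    have hd := frame_decomposition hb0 φ hc w
    have h3 := congrArg (fun y : E3 => y 2) hd
    rw [hw] at hd
    rw [hw, eastVector_ellipsoidPoint b φ hc] at h3
    have h4 : (northVector b (ellipsoidPoint b φ θ)) 2 ≠ 0 := by
      rw [northVector_ellipsoidPoint hb0 φ hc]
      simp [hb0.ne', hc.ne', hr.ne']
    have h5 : inner ℝ (northVector b (ellipsoidPoint b φ θ)) w = (0 : ℝ) := by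
      simpa [hw2, h4] using h3
    rw [h5, zero_smul, zero_smul, sub_zero, add_zero, real_inner_comm] at hd
    exact hd
  filter_upwards [h, (mem_nullL_iff.1 hv).1, third_component_eq_zero hb0 hb1 hv] with x h1 h2 h3
  exact h1 _ h2 h3

/-- The distance from the axis. -/
def axisDist (x : E3) : ℝ := √(x 0 ^ 2 + x 1 ^ 2)

theorem axisDist_ellipsoidPoint (φ : ℝ) {θ : ℝ} (hθ : 0 < cos θ) :
    axisDist (ellipsoidPoint b φ θ) = cos θ := by
  rw [axisDist, ellipsoidPoint]
  simp only [Matrix.cons_val_zero, Matrix.cons_val_one]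
  rw [show (cos θ * cos φ) ^ 2 + (cos θ * sin φ) ^ 2 = cos θ ^ 2 by
    linear_combination cos θ ^ 2 * sin_sq_add_cos_sq φ, Real.sqrt_sq hθ.le]

theorem measurable_axisDist : Measurable axisDist := by
  unfold axisDist
  fun_prop

theorem zonalMean_const_mul_of {θ c : ℝ} {k g : E3 → ℝ}
    (hk : ∀ φ, k (ellipsoidPoint b φ θ) = c) :
    zonalMean b θ (fun x => k x * g x) = c * zonalMean b θ g := by
  simp only [zonalMean_eq_integral, hk, integral_const_mul]

theorem memLp_axisDist_mul {g : E3 → ℝ} (hgm : Measurable g)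
    (hg : MemLp g 2 (surfaceMeasure b)) :
    MemLp (fun x => axisDist x * g x) 2 (surfaceMeasure b) := by
  refine hg.of_le (measurable_axisDist.mul hgm).aestronglyMeasurable ?_
  refine ae_surfaceMeasure_of_forall fun φ θ hθ => ?_
  rw [axisDist_ellipsoidPoint φ (cos_pos_of_mem hθ), norm_mul, Real.norm_eq_abs]
  exact mul_le_of_le_one_left (norm_nonneg _) (abs_cos_le_one θ)

theorem memLp_inner_east (u : L2Field b) :
    MemLp (fun x => (inner ℝ (u x) (eastVector x) : ℝ)) 2 (surfaceMeasure b) :=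
  memLp_inner_field (measurable_field u) (Lp.memLp u) measurable_eastVector norm_eastVector_le

theorem measurable_inner_east (u : L2Field b) :
    Measurable fun x => (inner ℝ (u x) (eastVector x) : ℝ) :=
  measurable_inner_field (measurable_field u) measurable_eastVector

/-- The eastward component of a field in the null space is independent of the longitude. -/
theorem inner_east_eq_zonalLift (hb0 : 0 < b) (hb1 : b < 1) {v : L2Field b} (hv : v ∈ nullL b) :
    ∀ᵐ x ∂(surfaceMeasure b), (inner ℝ (v x) (eastVector x) : ℝ) =
      zonalLift b (fun y => inner ℝ (v y) (eastVector y)) x := by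
  obtain ⟨hT, h1, -⟩ := mem_nullL_iff.1 hv
  set v₁ : E3 → ℝ := fun x => inner ℝ (v x) (eastVector x) with hv₁
  have hm : Measurable v₁ := measurable_inner_east v
  have hL : MemLp v₁ 2 (surfaceMeasure b) := memLp_inner_east v
  set w : E3 → ℝ := fun x => axisDist x * v₁ x with hw
  have hwm : Measurable w := measurable_axisDist.mul hm
  have hwL : MemLp w 2 (surfaceMeasure b) := memLp_axisDist_mul hm hL
  have hMw := memLp_zonalLift hb0 hwm hwL
  -- Weak form: for smooth h, ∫ w h = ∫ w M(h) by vanishing divergence and ∫ w M(h) = ∫ M(w) h by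
  -- symmetry, hence w = M(w).
  have hwz : ∀ᵐ x ∂(surfaceMeasure b), w x = zonalLift b w x := by
    refine ae_eq_of_integral_contDiff_smul_eq (hwL.integrable one_le_two).locallyIntegrable
      (hMw.integrable one_le_two).locallyIntegrable fun h hh _ => ?_
    have hhL := memLp_of_continuous b hh.continuous
    have hhm := hh.continuous.measurable
    simp only [smul_eq_mul]
    have hsymm := integral_zonalLift_mul hb0 hwm hhm hwL hhL
    have hiw : Integrable (fun x => w x * h x) (surfaceMeasure b) := hwL.integrable_mul hhL
    have hiM : Integrable (fun x => w x * zonalLift b h x) (surfaceMeasure b) :=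
      hwL.integrable_mul (memLp_zonalLift hb0 hhm hhL)
    -- The factor is cos² θ on the ellipsoid. One power of cos θ cancels the one in
    -- `fderiv_axialMean_id`, the other is absorbed in `w`; the square keeps the test function
    -- smooth at the poles.
    have hg : ContDiff ℝ ∞ fun x : E3 => (x 0 ^ 2 + x 1 ^ 2) * h x := by fun_prop
    have htest := h1 _ (contDiff_axialMean contDiff_id hg 0 (2 * π))
    have hpt : ∀ᵐ x ∂(surfaceMeasure b),
        fderiv ℝ (axialMean id (fun x : E3 => (x 0 ^ 2 + x 1 ^ 2) * h x) 0 (2 * π)) x (v x) =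
          2 * π * (w x * h x - w x * zonalLift b h x) := by
      have hq : ∀ᵐ x ∂(surfaceMeasure b),
          fderiv ℝ (axialMean id (fun x : E3 => (x 0 ^ 2 + x 1 ^ 2) * h x) 0 (2 * π)) x
            (eastVector x) = 2 * π * (axisDist x * h x - axisDist x * zonalLift b h x) := by
        refine ae_surfaceMeasure_of_forall fun φ θ hθ => ?_
        have hc := cos_pos_of_mem hθ
        have hd := fderiv_axialMean_id hg b φ hc
        have hsq : ∀ s, ellipsoidPoint b s θ 0 ^ 2 + ellipsoidPoint b s θ 1 ^ 2 = cos θ ^ 2 := by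
          intro s
          simp only [ellipsoidPoint, Matrix.cons_val_zero, Matrix.cons_val_one]
          linear_combination cos θ ^ 2 * sin_sq_add_cos_sq s
        rw [zonalMean_const_mul_of (k := fun x : E3 => x 0 ^ 2 + x 1 ^ 2) hsq, hsq] at hd
        rw [axisDist_ellipsoidPoint φ hc, zonalLift_ellipsoidPoint hb0 _ _ hθ]
        refine mul_left_cancel₀ hc.ne' (hd.trans ?_)
        ring
      filter_upwards [hq, nullL_eq_smul_east hb0 hb1 hv] with x hx hvx
      rw [hvx, map_smul, hx, smul_eq_mul, hw]
      ring
    rw [integral_congr_ae hpt, integral_const_mul, integral_sub hiw hiM, mul_eq_zero] at htest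
    have := htest.resolve_left (by positivity)
    simp only [mul_comm (h _)]
    rw [hsymm]
    linarith
  have hfact : ∀ᵐ x ∂(surfaceMeasure b), zonalLift b w x = axisDist x * zonalLift b v₁ x ∧
      axisDist x ≠ 0 := by
    refine ae_surfaceMeasure_of_forall fun φ θ hθ => ?_
    have hc := cos_pos_of_mem hθ
    rw [zonalLift_ellipsoidPoint hb0 _ _ hθ, zonalLift_ellipsoidPoint hb0 _ _ hθ,
      axisDist_ellipsoidPoint φ hc]
    exact ⟨zonalMean_const_mul_of fun s => axisDist_ellipsoidPoint s hc, hc.ne'⟩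
  filter_upwards [hwz, hfact] with x h1 h2
  rw [h2.1] at h1
  exact mul_left_cancel₀ h2.2 h1

/-! ### The projection -/

/-- The projection onto the null space replaces the eastward component by its zonal mean and
removes the northward component. -/
theorem projNull_ae_eq (hb0 : 0 < b) (hb1 : b < 1) (u : L2Field b) :
    ∀ᵐ x ∂(surfaceMeasure b), projNull b u x =
      zonalLift b (fun y => inner ℝ (u y) (eastVector y)) x • eastVector x := by
  set u₁ : E3 → ℝ := fun x => inner ℝ (u x) (eastVector x) with hu₁
  have hm : Measurable u₁ := measurable_inner_east u
  have hL : MemLp u₁ 2 (surfaceMeasure b) := memLp_inner_east u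
  have hML := memLp_zonalLift hb0 hm hL
  have hAL := memLp_smul_field (measurable_zonalLift b hm) hML measurable_eastVector
    norm_eastVector_le
  set A : L2Field b := hAL.toLp _ with hA
  have hAx : ∀ᵐ x ∂(surfaceMeasure b), A x = zonalLift b u₁ x • eastVector x := hAL.coeFn_toLp
  suffices h : projNull b u = A by rw [h]; exact hAx
  refine Submodule.eq_starProjection_of_mem_orthogonal (zonal_field_mem_nullL hb0 hAx) ?_
  rw [Submodule.mem_orthogonal']
  intro v hv
  set v₁ : E3 → ℝ := fun x => inner ℝ (v x) (eastVector x) with hv₁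
  have hvm : Measurable v₁ := measurable_inner_east v
  have hvL : MemLp v₁ 2 (surfaceMeasure b) := memLp_inner_east v
  have he : ∀ᵐ x ∂(surfaceMeasure b), inner ℝ (eastVector x) (eastVector x) = (1 : ℝ) :=
    ae_surfaceMeasure_of_forall fun φ θ hθ => inner_east_self b φ (cos_pos_of_mem hθ)
  -- It remains to see ⟨u, v⟩ = ⟨A, v⟩ for v = v₁ e. As v₁ = M(v₁), this is ∫ u₁ M(v₁) = ∫ M(u₁) v₁,
  -- the symmetry of the zonal mean.
  rw [inner_sub_left, L2.inner_def, L2.inner_def, sub_eq_zero]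
  have h1 : ∀ᵐ x ∂(surfaceMeasure b), inner ℝ (u x) (v x) = u₁ x * zonalLift b v₁ x := by
    filter_upwards [nullL_eq_smul_east hb0 hb1 hv, inner_east_eq_zonalLift hb0 hb1 hv]
      with x h1 h2
    rw [h1, inner_smul_right, h2, mul_comm]
  have h2 : ∀ᵐ x ∂(surfaceMeasure b), inner ℝ (A x) (v x) = zonalLift b u₁ x * v₁ x := by
    filter_upwards [nullL_eq_smul_east hb0 hb1 hv, hAx, he] with x h1 h2 h3
    rw [h1, h2, inner_smul_right, real_inner_smul_left, h3]
    ring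
  rw [integral_congr_ae h1, integral_congr_ae h2, integral_zonalLift_mul hb0 hm hvm hL hvL]

end

/-! ### Integrals over latitude circles -/

/-- The circle is traversed with speed cos θ, its radius. -/
theorem latitudeIntegral_eq (b : ℝ) {θ : ℝ} (hθ : 0 < cos θ) (h : E3 → ℝ) :
    latitudeIntegral b θ h = 2 * π * cos θ * zonalMean b θ h := by
  have hd : ∀ φ, ‖deriv (fun s => ellipsoidPoint b s θ) φ‖ = cos θ := fun φ => by
    have h1 := inner_east_self b φ hθ
    rw [real_inner_self_eq_norm_sq] at h1
    have h2 : ‖eastVector (ellipsoidPoint b φ θ)‖ = 1 :=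
      (pow_eq_one_iff_of_nonneg (norm_nonneg _) two_ne_zero).1 h1
    rw [(hasDerivAt_ellipsoidPoint b φ hθ).deriv, norm_smul, h2, mul_one, Real.norm_eq_abs,
      abs_of_pos hθ]
  simp only [latitudeIntegral, hd, intervalIntegral.integral_mul_const, zonalMean]
  field_simp

theorem latitudeIntegral_inner_east_self (b : ℝ) {θ : ℝ} (hθ : 0 < cos θ) :
    latitudeIntegral b θ (fun x => inner ℝ (eastVector x) (eastVector x)) = 2 * π * cos θ := by
  rw [latitudeIntegral_eq b hθ, zonalMean_eq_integral]
  simp only [inner_east_self b _ hθ]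
  simp

/-- Almost all slices of an integrable function are integrable over a full turn. -/
theorem ae_intervalIntegrable_slice {b : ℝ} (hb : 0 < b) {h : E3 → ℝ}
    (hh : Integrable h (surfaceMeasure b)) :
    ∀ᵐ θ ∂(volume.restrict (Icc (-(π / 2)) (π / 2))),
      IntervalIntegrable (fun φ => h (ellipsoidPoint b φ θ)) volume (-π) π := by
  refine ae_restrict_of_ae_latMeasure hb ?_
  filter_upwards [integrable_slice hh] with θ hθ
  rw [intervalIntegrable_iff_integrableOn_Ico_of_le (by linarith [Real.pi_pos])]
  unfold lonMeasure at hθ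
  rwa [integrable_smul_measure (ENNReal.inv_ne_zero.2 ENNReal.ofReal_ne_top)
    (ENNReal.inv_ne_top.2 ofReal_two_pi_ne_zero)] at hθ

/-- In terms of the polar colatitude, `cos θ = sin ϑ / √(sin² ϑ + cos² ϑ / b²)`. -/
theorem one_div_cos_eq_of_sphericalPoint {b : ℝ} (hb : 0 < b) {φ θ r ϑ : ℝ}
    (hr : 0 < r) (h0 : 0 < ϑ) (hπ : ϑ < π)
    (h : ellipsoidPoint b φ θ = sphericalPoint r ϑ φ) :
    1 / (2 * π * cos θ) = √(sin ϑ ^ 2 + cos ϑ ^ 2 / b ^ 2) / (2 * π * sin ϑ) := by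
  have hs : 0 < sin ϑ := sin_pos_of_pos_of_lt_pi h0 hπ
  have e0 : cos θ * cos φ = r * sin ϑ * cos φ := by
    simpa [ellipsoidPoint, sphericalPoint] using congrArg (fun y : E3 => y 0) h
  have e1 : cos θ * sin φ = r * sin ϑ * sin φ := by
    simpa [ellipsoidPoint, sphericalPoint] using congrArg (fun y : E3 => y 1) h
  have e2 : b * sin θ = r * cos ϑ := by
    simpa [ellipsoidPoint, sphericalPoint] using congrArg (fun y : E3 => y 2) h
  have hcos : cos θ = r * sin ϑ := by
    linear_combination (-cos θ + r * sin ϑ) * sin_sq_add_cos_sq φ + cos φ * e0 + sin φ * e1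
  -- The ellipsoid equation in polar form: substituting cos θ = r sin ϑ and sin θ = r cos ϑ / b in
  -- sin² θ + cos² θ = 1 shows that the square root is 1/r.
  have hsq : sin ϑ ^ 2 + cos ϑ ^ 2 / b ^ 2 = (1 / r) ^ 2 := by
    have h3 : sin θ = r * cos ϑ / b := by
      field_simp
      linear_combination e2
    have h4 := sin_sq_add_cos_sq θ
    rw [h3, hcos] at h4
    field_simp at h4 ⊢
    linear_combination h4
  rw [hsq, Real.sqrt_sq (by positivity), hcos]
  field_simp

/-! ### Stream functions -/

/-- Averaging over rotations of space extends the zonal mean of a smooth function to a function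
smooth on all of space, so the poles need no separate treatment. -/
theorem axialMean_const_ellipsoidPoint (b φ θ : ℝ) (f : E3 → ℝ) :
    axialMean (fun _ => (2 * π)⁻¹) f (-π) π (ellipsoidPoint b φ θ) = zonalMean b θ f := by
  have h := intervalIntegral_shift_eq_zonalMean b φ θ f (-π)
  rw [show -π + 2 * π = π by ring] at h
  simp only [axialMean, axialRotation_ellipsoidPoint, intervalIntegral.integral_const_mul, h]
  field_simp

/-- The gradient of the zonal mean is the zonal mean of the northward derivative. -/
theorem surfGrad_axialMean {b : ℝ} (hb : 0 < b) {f : E3 → ℝ} (hf : ContDiff ℝ ∞ f) (φ : ℝ)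
    {θ : ℝ} (hθ : 0 < cos θ) :
    surfGrad b (axialMean (fun _ => (2 * π)⁻¹) f (-π) π) (ellipsoidPoint b φ θ) =
      zonalMean b θ (fun x => inner ℝ (surfGrad b f x) (northVector b x)) •
        northVector b (ellipsoidPoint b φ θ) := by
  have hE := intervalIntegral_shift_eq_zonalMean b φ θ (fun x => fderiv ℝ f x (eastVector x)) (-π)
  have hN := intervalIntegral_shift_eq_zonalMean b φ θ
    (fun x => fderiv ℝ f x (northVector b x)) (-π)
  rw [show -π + 2 * π = π by ring] at hE hN
  rw [surfGrad, frame_decomposition hb φ hθ, inner_gradient_eq, inner_gradient_eq,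
    fderiv_axialMean contDiff_const hf, fderiv_axialMean contDiff_const hf]
  -- Rotations carry the frame to the frame, so each component of the gradient becomes a mean of the
  -- same component of ∇f; the eastward mean vanishes.
  simp only [axialRotation_ellipsoidPoint, axialRotation_eastVector b _ φ hθ,
    axialRotation_northVector hb _ φ hθ, intervalIntegral.integral_const_mul]
  rw [hE, hN, zonalMean_fderiv_eastVector hf b hθ, mul_zero, mul_zero, zero_smul, zero_add]
  congr 1
  have h : (fun x => inner ℝ (surfGrad b f x) (northVector b x)) =
      fun x => fderiv ℝ f x (northVector b x) := by
    funext x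
    rw [real_inner_comm]
    exact inner_surfGrad_eq f (inner_unitNormal_rotPerp b x _)
  rw [h]
  field_simp

theorem measurable_surfGrad (b : ℝ) {f : E3 → ℝ} (hf : ContDiff ℝ ∞ f) :
    Measurable (surfGrad b f) := by
  have hg : Measurable (gradient f) := ((InnerProductSpace.toDual ℝ E3).symm.continuous.comp
    (hf.continuous_fderiv (by simp))).measurable
  have hn := measurable_unitNormal b
  unfold surfGrad
  fun_prop

/-- The zonal mean of a Sobolev function is a Sobolev function. -/
theorem hasSobolevGrad_zonalLift {b : ℝ} (hb : 0 < b) {Ψ Ψ' : L2Fun b} {G G' : L2Field b}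
    (h : HasSobolevGrad b Ψ G)
    (hΨ' : ∀ᵐ x ∂(surfaceMeasure b), Ψ' x = zonalLift b Ψ x)
    (hG' : ∀ᵐ x ∂(surfaceMeasure b), G' x =
      zonalLift b (fun y => inner ℝ (G y) (northVector b y)) x • northVector b x) :
    HasSobolevGrad b Ψ' G' := by
  obtain ⟨-, f, hf, hlim, hglim⟩ := h
  have hΨm : Measurable (Ψ : E3 → ℝ) := (Lp.stronglyMeasurable Ψ).measurable
  have hGm := measurable_field G
  -- The approximating functions are averaged over rotations; both convergences follow from the
  -- contraction property, for gradients applied to the northward component.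
  refine ⟨?_, fun k => axialMean (fun _ => (2 * π)⁻¹) (f k) (-π) π,
    fun k => contDiff_axialMean contDiff_const (hf k) _ _, ?_, ?_⟩
  · unfold IsTangent
    filter_upwards [hG'] with x hx
    rw [hx, inner_smul_right, northVector, inner_unitNormal_rotPerp, mul_zero]
  · refine tendsto_of_tendsto_of_tendsto_of_le_of_le tendsto_const_nhds hlim
      (fun _ => zero_le) fun k => ?_
    have hfc := (hf k).continuous
    refine le_trans (le_of_eq (eLpNorm_congr_ae ?_))
      (eLpNorm_zonalLift_le hb (hfc.measurable.sub hΨm))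
    have h1 : ∀ᵐ x ∂(surfaceMeasure b),
        axialMean (fun _ => (2 * π)⁻¹) (f k) (-π) π x = zonalLift b (f k) x :=
      ae_surfaceMeasure_of_forall fun φ θ hθ => by
        rw [axialMean_const_ellipsoidPoint, zonalLift_ellipsoidPoint hb _ _ hθ]
    filter_upwards [h1, hΨ', zonalLift_sub_ae hb
      ((memLp_of_continuous b hfc).integrable one_le_two)
      ((Lp.memLp Ψ).integrable one_le_two)] with x h1 h2 h3
    rw [h1, h2]
    exact h3.symm
  · refine tendsto_of_tendsto_of_tendsto_of_le_of_le tendsto_const_nhds hglim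
      (fun _ => zero_le) fun k => ?_
    have hsm := measurable_surfGrad b (hf k)
    have hNm := measurable_northVector b
    have h1 : ∀ᵐ x ∂(surfaceMeasure b),
        surfGrad b (axialMean (fun _ => (2 * π)⁻¹) (f k) (-π) π) x =
          zonalLift b (fun y => inner ℝ (surfGrad b (f k) y) (northVector b y)) x •
            northVector b x :=
      ae_surfaceMeasure_of_forall fun φ θ hθ => by
        rw [surfGrad_axialMean hb (hf k) φ (cos_pos_of_mem hθ),
          zonalLift_ellipsoidPoint hb _ _ hθ]
    have h2 := zonalLift_sub_ae hb
      ((memLp_inner_field hsm (memLp_surfGrad b (hf k)) hNm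
        (norm_northVector_le b)).integrable one_le_two)
      ((memLp_inner_field hGm (Lp.memLp G) hNm (norm_northVector_le b)).integrable one_le_two)
    calc _ ≤ eLpNorm (zonalLift b fun y => inner ℝ (surfGrad b (f k) y) (northVector b y) -
            inner ℝ (G y) (northVector b y)) 2 (surfaceMeasure b) := by
          refine eLpNorm_mono_ae ?_
          filter_upwards [h1, h2, hG'] with x h1 h2 h3
          rw [h1, h3, h2, ← sub_smul, norm_smul]
          exact mul_le_of_le_one_right (norm_nonneg _) (norm_northVector_le b x)
      _ ≤ eLpNorm (fun y => (inner ℝ (surfGrad b (f k) y) (northVector b y) : ℝ) -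
            inner ℝ (G y) (northVector b y)) 2 (surfaceMeasure b) :=
          eLpNorm_zonalLift_le hb
            ((measurable_inner_field hsm hNm).sub (measurable_inner_field hGm hNm))
      _ ≤ _ := by
          refine eLpNorm_mono fun x => ?_
          rw [← inner_sub_left]
          exact abs_inner_le_of_norm_le_one (norm_northVector_le b x) _

/-- The projection of `∇^⊥ Ψ` is `∇^⊥` of the zonal mean of `Ψ`. -/
theorem projNull_rotPerp_gradient {b : ℝ} (hb0 : 0 < b) (hb1 : b < 1) {u : L2Field b}
    {Ψ : L2Fun b} {G : L2Field b} (h : HasSobolevGrad b Ψ G)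
    (hu : ∀ᵐ x ∂(surfaceMeasure b), u x = rotPerp b x (G x)) :
    ∃ (Ψ' : L2Fun b) (G' : L2Field b), HasSobolevGrad b Ψ' G' ∧
      (∀ᵐ p ∂(coordArea b), Ψ' (ellipsoidPoint b p.1 p.2) = zonalMean b p.2 Ψ) ∧
      ∀ᵐ x ∂(surfaceMeasure b), projNull b u x = rotPerp b x (G' x) := by
  have hΨm : Measurable (Ψ : E3 → ℝ) := (Lp.stronglyMeasurable Ψ).measurable
  have hNm := measurable_northVector b
  have hgm := measurable_inner_field (measurable_field G) hNm
  have hΨ'L := memLp_zonalLift hb0 hΨm (Lp.memLp Ψ)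
  have hG'L := memLp_smul_field (measurable_zonalLift b hgm)
    (memLp_zonalLift hb0 hgm (memLp_inner_field (measurable_field G) (Lp.memLp G) hNm
      (norm_northVector_le b))) hNm (norm_northVector_le b)
  refine ⟨hΨ'L.toLp _, hG'L.toLp _, hasSobolevGrad_zonalLift hb0 h hΨ'L.coeFn_toLp hG'L.coeFn_toLp, ?_, ?_⟩
  · filter_upwards [ae_coordArea_of_ae_surface hΨ'L.coeFn_toLp, ae_coordArea_mem b] with p h1 h2
    rw [h1, zonalLift_ellipsoidPoint hb0 _ _ h2]
  -- G^⊥ · e = -G · e^⊥ = -G · N, and N^⊥ = -e: the two signs cancel.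
  · have h1 : ∀ᵐ x ∂(surfaceMeasure b), (inner ℝ (u x) (eastVector x) : ℝ) =
        -inner ℝ (G x) (northVector b x) := by
      filter_upwards [hu] with x hx
      rw [hx, inner_rotPerp, northVector]
    have h2 : ∀ᵐ x ∂(surfaceMeasure b),
        rotPerp b x (northVector b x) = -eastVector x :=
      ae_surfaceMeasure_of_forall fun φ θ hθ => rotPerp_northVector hb0 φ (cos_pos_of_mem hθ)
    filter_upwards [projNull_ae_eq hb0 hb1 u, zonalLift_congr_ae hb0 h1, h2, hG'L.coeFn_toLp]
      with x h3 h4 h5 h6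
    have h7 : zonalLift b (fun y => -inner ℝ (G y) (northVector b y)) x =
        -zonalLift b (fun y => inner ℝ (G y) (northVector b y)) x := by
      simp only [zonalLift, zonalMean_eq_integral, integral_neg]
    rw [h3, h4, h6, h7, rotPerp_smul, h5, neg_smul, smul_neg]

end

/-! ### The main theorem -/

theorem lemma3p2 (b : ℝ) (hb0 : 0 < b) (hb1 : b < 1) (u : L2Field b) (hu : IsDivFree b u) :
    -- the line integrals of `u · e_φ` converge on almost every latitude circle
    (∀ᵐ θ ∂(volume.restrict (Icc (-(π / 2)) (π / 2))),
      IntervalIntegrable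
        (fun φ => (inner ℝ (u (ellipsoidPoint b φ θ)) (eastVector (ellipsoidPoint b φ θ)) : ℝ))
        volume (-π) π) ∧
    -- `Π u = Π A = A` for the field `A = (∮ u · e_φ) e_φ / ∮ e_φ · e_φ`
    (∃ A : L2Field b,
      (∀ᵐ p ∂(coordArea b), A (ellipsoidPoint b p.1 p.2) =
        (latitudeIntegral b p.2 (fun x => inner ℝ (u x) (eastVector x)) /
          latitudeIntegral b p.2 (fun x => inner ℝ (eastVector x) (eastVector x))) •
            eastVector (ellipsoidPoint b p.1 p.2)) ∧
      projNull b u = projNull b A ∧ projNull b u = A) ∧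
    -- the explicit factor, in the parametric latitude `θ`
    (∀ᵐ p ∂(coordArea b), projNull b u (ellipsoidPoint b p.1 p.2) =
      (1 / (2 * π * cos p.2) *
        latitudeIntegral b p.2 (fun x => inner ℝ (u x) (eastVector x))) •
          eastVector (ellipsoidPoint b p.1 p.2)) ∧
    -- the explicit factor, in the polar colatitude `ϑ` of the same point
    (∀ᵐ p ∂(coordArea b), ∀ r ϑ : ℝ, 0 < r → 0 < ϑ → ϑ < π →
      ellipsoidPoint b p.1 p.2 = sphericalPoint r ϑ p.1 →
      projNull b u (ellipsoidPoint b p.1 p.2) =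
        (√(sin ϑ ^ 2 + cos ϑ ^ 2 / b ^ 2) / (2 * π * sin ϑ) *
          latitudeIntegral b p.2 (fun x => inner ℝ (u x) (eastVector x))) •
            eastVector (ellipsoidPoint b p.1 p.2)) ∧
    -- the stream function is sent to its zonal mean
    (∀ (Ψ : L2Fun b) (G : L2Field b), HasSobolevGrad b Ψ G →
      (∀ᵐ x ∂(surfaceMeasure b), u x = rotPerp b x (G x)) →
      ∃ (Ψ' : L2Fun b) (G' : L2Field b), HasSobolevGrad b Ψ' G' ∧
        (∀ᵐ p ∂(coordArea b), Ψ' (ellipsoidPoint b p.1 p.2) = zonalMean b p.2 Ψ) ∧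
        ∀ᵐ x ∂(surfaceMeasure b), projNull b u x = rotPerp b x (G' x)) := by
  have hint := (memLp_inner_east u).integrable one_le_two
  have hA : ∀ᵐ p ∂(coordArea b), p.2 ∈ Ioo (-(π / 2)) (π / 2) ∧
      projNull b u (ellipsoidPoint b p.1 p.2) =
        zonalMean b p.2 (fun x => inner ℝ (u x) (eastVector x)) •
          eastVector (ellipsoidPoint b p.1 p.2) := by
    filter_upwards [ae_coordArea_of_ae_surface (projNull_ae_eq hb0 hb1 u), ae_coordArea_mem b]
      with p h1 h2
    exact ⟨h2, by rw [h1, zonalLift_ellipsoidPoint hb0 _ _ h2]⟩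
  have hexplicit : ∀ᵐ p ∂(coordArea b), 0 < cos p.2 ∧
      projNull b u (ellipsoidPoint b p.1 p.2) = (1 / (2 * π * cos p.2) *
        latitudeIntegral b p.2 (fun x => inner ℝ (u x) (eastVector x))) •
          eastVector (ellipsoidPoint b p.1 p.2) := by
    filter_upwards [hA] with p hp
    have hc := cos_pos_of_mem hp.1
    refine ⟨hc, ?_⟩
    rw [hp.2, latitudeIntegral_eq b hc]
    congr 1
    field_simp
  -- The witness for the averaged field is the projection itself: `hexplicit` shows that it has the
  -- required form, and Π A = A is idempotence.
  refine ⟨ae_intervalIntegrable_slice hb0 hint, ⟨projNull b u, ?_, ?_, rfl⟩, ?_, ?_, ?_⟩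
  · filter_upwards [hexplicit] with p hp
    rw [hp.2, latitudeIntegral_inner_east_self b hp.1, one_div_mul_eq_div]
  · exact (Submodule.starProjection_eq_self_iff.2
      (Submodule.starProjection_apply_mem (nullL b) u)).symm
  · exact hexplicit.mono fun p hp => hp.2
  · filter_upwards [hexplicit] with p hp r ϑ hr h0 hπ heq
    rw [hp.2, one_div_cos_eq_of_sphericalPoint hb0 hr h0 hπ heq]
  · exact fun Ψ G h hG => projNull_rotPerp_gradient hb0 hb1 h hG
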